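/- Let $K$ be a number field with ring of integers $\mathcal O_K$ and algebraic closure $\overline K$, let $k\in K^*$, and let $\phi(x)=k(x^2+1)/x$, regarded as a map $\mathbb P^1\to\mathbb P^1$. For $n\ge 1$ define $P_n,Q_n\in K[X,Y]$ by $P_1=k(X^2+Y^2)$, $Q_1=XY$, $P_n=k(P_{n-1}^2+Q_{n-1}^2)$ and $Q_n=P_{n-1}Q_{n-1}$ for $n\geq 2$. Put $\delta_n=kP_n(1,1)\in K$, and let $a_n\in\mathbb Z$ be the value of $P_n(1,1)$ when $k=1$ (so $a_1=2$, $a_2=5$, $a_3=29$). For $m\ge 1$ let $V_m=\phi^{-m}(0)\subset\mathbb P^1(\overline K)$ (here $\infty\notin V_m$), let $K_m=K(V_m)$ and $G_m=\mathrm{Gal}(K_m/K)$. Let $T_m$ be the rooted tree with root $0$ whose further vertices are the elements of $V_1\cup\dots\cup V_m$, each vertex $v\ne 0$ being joined to its parent $\phi(v)$, and let $C_m$ be the centralizer, in the group $\mathrm{Aut}(T_m)$ of rooted tree automorphisms, of the automorphism $\iota$ induced by $x\mapsto -x$. Let $m\ge 1$. Assume that $-1$ is not a square in $K$, that none of the fractional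 $\mathcal O_K$-ideals $(\delta_2),(\delta_3),\dots,(\delta_m)$ is the square of a fractional $\mathcal O_K$-ideal, and that $v_{\mathfrak p}(k)=0$ for every prime $\mathfrak p$ of $\mathcal O_K$ that divides $a_n$ for some $n$ with $1\le n<m/2+1$. Then $G_m\cong C_m$; more precisely, every vertex of $T_m$ lies in $K_m$, and the natural action of $G_m$ on the vertices of $T_m$ is an isomorphism of $G_m$ onto $C_m\subseteq\mathrm{Aut}(T_m)$. -/

import Mathlib

open scoped nonZeroDivisors NumberField

namespace Arboreal

noncomputable section

/-- The lift `(X, Y) ↦ (k (X² + Y²), X Y)` to the affine plane of the map `k (x² + 1) / x`. -/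
def lift {R : Type*} [CommRing R] (k : R) (v : R × R) : R × R :=
  (k * (v.1 ^ 2 + v.2 ^ 2), v.1 * v.2)

/-- The value `P_n(X, Y)`: the first coordinate of the `n`-th iterate of the lift. -/
def P {R : Type*} [CommRing R] (k : R) (n : ℕ) (X Y : R) : R :=
  ((lift k)^[n] (X, Y)).1

/-- `δ_n = k P_n(1, 1)`. -/
def delta {R : Type*} [CommRing R] (k : R) (n : ℕ) : R :=
  k * P k n 1 1

/-- `a_n`, the value of `P_n(1, 1)` for `k = 1`, an integer. -/
def a (n : ℕ) : ℤ :=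
  P 1 n 1 1

/-- The rational map `φ(x) = k (x² + 1) / x` on the projective line `F ∪ {∞}` (for `k ≠ 0`):
both `∞` and `0` go to `∞`. -/
def phi {F : Type*} [Field F] (k : F) (z : OnePoint F) : OnePoint F :=
  open scoped Classical in
  z.elim OnePoint.infty
    (fun x => if x = 0 then OnePoint.infty else ((k * (x ^ 2 + 1) / x : F) : OnePoint F))

/-- The involution `x ↦ -x` of the projective line (it fixes `∞`). -/
def neg {F : Type*} [Field F] (z : OnePoint F) : OnePoint F :=
  z.map (fun x => -x)

/-- `V_n = φ⁻ⁿ(0)`, a subset of the projective line. -/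
def V {F : Type*} [Field F] (k : F) (n : ℕ) : Set (OnePoint F) :=
  {z | (phi k)^[n] z = ((0 : F) : OnePoint F)}

/-- The vertices of the preimage tree of `0`, truncated at level `m`. The root `0` (level zero)
is included. -/
def T {F : Type*} [Field F] (k : F) (m : ℕ) : Set (OnePoint F) :=
  {z | ∃ i ≤ m, z ∈ V k i}

/-- The edges of the tree, directed towards the root: `w` is the parent of `v`. -/
def edge {F : Type*} [Field F] (k : F) (m : ℕ) (v w : T k m) : Prop :=
  phi k v = w

/-- The group of automorphisms of the rooted tree `T_m`: permutations of the vertices that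
preserve the parent relation (the root, as the only vertex without a parent, is then fixed). -/
abbrev TreeAut {F : Type*} [Field F] (k : F) (m : ℕ) : Type _ :=
  edge k m ≃r edge k m

theorem neg_neg' {F : Type*} [Field F] (z : OnePoint F) : neg (neg z) = z := by
  induction z using OnePoint.rec <;> simp [neg]

theorem phi_neg {F : Type*} [Field F] (k : F) (z : OnePoint F) :
    phi k (neg z) = neg (phi k z) := by
  induction z using OnePoint.rec with
  | infty => simp [neg, phi]
  | coe x =>
    by_cases hx : x = 0
    · simp [neg, phi, hx]
    · simp [neg, phi, hx, div_neg]

theorem neg_mem_T {F : Type*} [Field F] (k : F) (m : ℕ) {z : OnePoint F} (hz : z ∈ T k m) :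
    neg z ∈ T k m := by
  obtain ⟨i, hi, hz⟩ := hz
  refine ⟨i, hi, ?_⟩
  have hc : Function.Semiconj (neg (F := F)) (phi k) (phi k) := fun w => (phi_neg k w).symm
  have h := (hc.iterate_right i) z
  simp only [V, Set.mem_ofPred_eq] at hz ⊢
  rw [← h, hz]
  simp [neg]

/-- The automorphism of `T_m` induced by `x ↦ -x`. -/
def iota {F : Type*} [Field F] (k : F) (m : ℕ) : TreeAut k m where
  toFun v := ⟨neg v, neg_mem_T k m v.2⟩
  invFun v := ⟨neg v, neg_mem_T k m v.2⟩
  left_inv v := Subtype.ext (neg_neg' _)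
  right_inv v := Subtype.ext (neg_neg' _)
  map_rel_iff' := by
    intro v w
    simp only [edge, Equiv.coe_fn_mk, phi_neg]
    exact ⟨fun h => by rw [← neg_neg' (phi k v), h, neg_neg'], fun h => by rw [h]⟩

/-- `C_m`, the centralizer of `ι` in `Aut(T_m)`. -/
def C {F : Type*} [Field F] (k : F) (m : ℕ) : Subgroup (TreeAut k m) :=
  Subgroup.centralizer {iota k m}

/-- `K_m = K(V_m)`, inside an algebraic closure of `K`. (The point `∞` is never in `V_m`.) -/
def preimageField {K : Type*} [Field K] (k : K) (m : ℕ) :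
    IntermediateField K (AlgebraicClosure K) :=
  IntermediateField.adjoin K
    {x | (x : OnePoint (AlgebraicClosure K)) ∈ V (algebraMap K (AlgebraicClosure K) k) m}

/-- `G_m = Gal(K_m / K)`. -/
abbrev G {K : Type*} [Field K] (k : K) (m : ℕ) : Type _ :=
  preimageField k m ≃ₐ[K] preimageField k m

end

end Arboreal

namespace Arboreal

/-! Let r be a square root of −1, so that φ⁻¹(0) = {r, −r}. Since φ(−x) = −φ(x), an element of C_m
is determined by its effect on {r, −r} and on the half of the tree above r. As −1 is not a square in
K, some Galois element swaps the two halves. It remains to realise every automorphism of the binary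
tree above r by a Galois element fixing r.

This is done level by level. The fibre of φ(x) = k(x + 1/x) over b is {s_b, 1/s_b}. The Galois
elements fixing levels 0, …, n above r give a subgroup W of 𝔽₂^S, where S is level n. It is stable
under the stabilizer of r, which acts on S transitively and through a 2-group, so a proper W lies in
the sum-zero hyperplane (`eq_top_of_sum_ne_zero`). Hence W is everything unless D = ∏ (s_b − 1/s_b)
lies in the field L_n generated by levels 0, …, n (`IsTransitiveAt.isFullAt`).

Up to a factor in L_n, D is a square root of δ_{n+2} (`exists_delta_eq_sq`). Suppose D ∈ L_n. As
(δ_{n+2}) is not a square, δ_{n+2} has odd valuation at some prime. The hypothesis on k makes k and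
P_i(1,1), 1 ≤ i ≤ n+1, units there, hence also 2 (`valuation_eq_one_of_delta`). Then L_n is built by
adjoining square roots x − 1/x of units in odd residue characteristic, so its value group is that of
K (`exists_valuation_eq_of_mem_adjoin_ball`), and δ_{n+2}, a square in L_n, has even valuation: a
contradiction (`prod_notMem_adjoin_ball`). -/

/-! ### Submodules of 𝔽₂^S under a transitive 2-group. -/

/-- A stable subgroup of `𝔽₂^S`, for a `2`-group acting transitively on `S`, is everything as soon
as it contains a vector with nonzero coordinate sum. -/
theorem eq_top_of_sum_ne_zero {Q S : Type*} [Group Q] [MulAction Q S] [Fintype S]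
    [MulAction.IsPretransitive Q S] (hQ : ∀ g : Q, ∃ n : ℕ, ∀ s : S, g ^ 2 ^ n • s = s)
    (W : AddSubgroup (S → ZMod 2)) (hW : ∀ g : Q, ∀ w ∈ W, (fun s => w (g⁻¹ • s)) ∈ W)
    {w₀ : S → ZMod 2} (hw₀ : w₀ ∈ W) (hsum : ∑ s, w₀ s ≠ 0) : W = ⊤ := by
  classical
  by_contra hne
  let W' : Submodule (ZMod 2) (S → ZMod 2) := AddSubgroup.toZModSubmodule 2 W
  have hmem : ∀ w, w ∈ W' ↔ w ∈ W := fun w => Iff.rfl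
  have hlt : W' < ⊤ := by
    rw [lt_top_iff_ne_top]
    intro h
    apply hne
    ext w
    rw [← hmem, h]
    simp
  obtain ⟨f, hf0, hf⟩ := Submodule.exists_le_ker_of_lt_top W' hlt
  let U : AddSubgroup (S → ZMod 2) :=
    { carrier := {u | ∀ w ∈ W, ∑ s, u s * w s = 0}
      zero_mem' := by intro w _; simp
      add_mem' := by
        intro a b ha hb w hw
        simp only [Pi.add_apply, add_mul, Finset.sum_add_distrib, ha w hw, hb w hw, add_zero]
      neg_mem' := by
        intro a ha w hw
        simp only [Pi.neg_apply, neg_mul, Finset.sum_neg_distrib, ha w hw, neg_zero] }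
  let u₁ : S → ZMod 2 := fun s => f (Pi.single s 1)
  have hfu : ∀ w, f w = ∑ s, u₁ s * w s := by
    intro w
    conv_lhs => rw [← Finset.univ_sum_single w]
    rw [map_sum]
    refine Finset.sum_congr rfl fun s _ => ?_
    have : (Pi.single s (w s) : S → ZMod 2) = w s • Pi.single s 1 := by
      rw [← Pi.single_smul]; simp
    rw [this, map_smul, smul_eq_mul, mul_comm]
  have hu₁ : u₁ ∈ U := fun w hw => by
    rw [← hfu]
    exact LinearMap.mem_ker.1 (hf ((hmem w).2 hw))
  have hu₁0 : u₁ ≠ 0 := by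
    intro h
    apply hf0
    refine LinearMap.ext fun w => ?_
    rw [hfu]
    simp [h]
  let φ := MulAction.toPermHom Q S
  -- Only the image of Q in the permutations of S has to be a 2-group.
  have hR : IsPGroup 2 φ.range := by
    rintro ⟨_, g, rfl⟩
    obtain ⟨n, hn⟩ := hQ g
    refine ⟨n, Subtype.ext (Equiv.ext fun s => ?_)⟩
    have : (φ g ^ 2 ^ n) s = g ^ 2 ^ n • s := by rw [← map_pow]; rfl
    simpa using this.trans (hn s)
  let act : MulAction φ.range U :=
    { smul := fun g u => ⟨fun s => u.1 (g.1⁻¹ s), by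
        obtain ⟨_, g, rfl⟩ := g
        intro w hw
        have := u.2 _ (hW g⁻¹ w hw)
        rw [← this]
        refine Fintype.sum_equiv (φ g)⁻¹ _ _ fun s => ?_
        rw [← map_inv]
        simp [φ]⟩
      one_smul := fun u => Subtype.ext (funext fun s => by
        change u.1 _ = u.1 _
        simp)
      mul_smul := fun g h u => Subtype.ext (funext fun s => by
        change u.1 _ = u.1 _
        simp) }
  have hcard : 2 ∣ Nat.card U := by
    have h2 : addOrderOf (⟨u₁, hu₁⟩ : U) = 2 := by
      refine addOrderOf_eq_prime ?_ ?_
      · ext s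
        simp only [AddSubgroup.coe_nsmul, Pi.smul_apply, ZeroMemClass.coe_zero, Pi.zero_apply]
        rw [two_nsmul]
        exact CharTwo.add_self_eq_zero _
      · intro h
        exact hu₁0 (congrArg Subtype.val h)
    exact h2.symm.dvd.trans (addOrderOf_dvd_natCard _)
  -- U has even order and 0 is fixed, so a second vector is fixed too; transitivity makes it
  -- constant.
  obtain ⟨u, hu, hu0⟩ := hR.exists_fixed_point_of_prime_dvd_card_of_fixed_point U hcard
    (a := 0) (fun g => Subtype.ext (funext fun s => rfl))
  have hconst : ∀ s t, u.1 s = u.1 t := by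
    intro s t
    obtain ⟨g, rfl⟩ := MulAction.exists_smul_eq Q s t
    have := congrFun (congrArg Subtype.val (hu ⟨φ g, g, rfl⟩)) (g • s)
    change u.1 ((φ g)⁻¹ (g • s)) = _ at this
    rw [← this, ← map_inv]
    simp [φ]
  have hex : ∃ s, u.1 s ≠ 0 := by
    by_contra! h
    exact hu0 (Subtype.ext (funext fun s => (h s).symm))
  obtain ⟨s, hs⟩ := hex
  have h1 := u.2 w₀ hw₀
  simp only [fun t => hconst t s, ← Finset.mul_sum] at h1
  exact (mul_ne_zero hs hsum) h1

/-! ### Even valuations and square ideals. -/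

open IsDedekindDomain in
theorem valuation_eq_exp_neg_count {R K : Type*} [CommRing R] [IsDedekindDomain R] [Field K]
    [Algebra R K] [IsFractionRing R K] (p : HeightOneSpectrum R) {r : R} (hr : r ≠ 0) :
    p.valuation K (algebraMap R K r) =
      WithZero.exp (-FractionalIdeal.count K p
        (FractionalIdeal.spanSingleton R⁰ (algebraMap R K r))) := by
  classical
  have h0 : Ideal.span {r} ≠ 0 := by simpa using hr
  rw [← FractionalIdeal.coeIdeal_span_singleton, FractionalIdeal.count_coe K p h0,
    HeightOneSpectrum.valuation_of_algebraMap, HeightOneSpectrum.intValuation_def, if_neg hr]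

open IsDedekindDomain in
/-- An element whose valuations are all even generates the square of a fractional ideal. -/
theorem isSquare_spanSingleton {R K : Type*} [CommRing R] [IsDedekindDomain R] [Field K]
    [Algebra R K] [IsFractionRing R K] (d : K)
    (h : ∀ p : HeightOneSpectrum R, ∃ c : K, p.valuation K d = p.valuation K c ^ 2) :
    IsSquare (FractionalIdeal.spanSingleton R⁰ d) := by
  classical
  obtain ⟨x, y, hy, rfl⟩ := IsFractionRing.div_surjective (A := R) d
  have hy0 : algebraMap R K y ≠ 0 := by
    simpa using nonZeroDivisors.ne_zero hy
  by_cases hx : x = 0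
  · subst hx
    simp [FractionalIdeal.spanSingleton_zero]
  have hxy : x * y ≠ 0 := mul_ne_zero hx (nonZeroDivisors.ne_zero hy)
  -- xy = d·y² differs from d by a square and is integral; halving its even exponents gives the
  -- root.
  have key : IsSquare (FractionalIdeal.spanSingleton R⁰ (algebraMap R K (x * y))) := by
    set I := FractionalIdeal.spanSingleton R⁰ (algebraMap R K (x * y)) with hI
    have hI0 : I ≠ 0 := by
      rw [hI, Ne, FractionalIdeal.spanSingleton_eq_zero_iff]
      simpa using hxy
    have heven : ∀ p : HeightOneSpectrum R, ∃ e : ℤ, FractionalIdeal.count K p I = e + e := by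
      intro p
      obtain ⟨c, hc⟩ := h p
      have h1 : p.valuation K (algebraMap R K (x * y)) = p.valuation K (c * algebraMap R K y) ^ 2 := by
        rw [map_mul (p.valuation K), mul_pow, ← hc, map_div₀, map_mul, map_mul]
        have : p.valuation K (algebraMap R K y) ≠ 0 := by simpa using hy0
        field_simp
      rw [valuation_eq_exp_neg_count p hxy, ← hI] at h1
      have hc0 : p.valuation K (c * algebraMap R K y) ≠ 0 := by
        intro h0
        rw [h0] at h1
        simp at h1
      obtain ⟨e, he⟩ : ∃ e : ℤ, p.valuation K (c * algebraMap R K y) = WithZero.exp e :=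
        ⟨_, (WithZero.exp_log hc0).symm⟩
      rw [he, pow_two, ← WithZero.exp_add, WithZero.exp_inj] at h1
      exact ⟨-e, by omega⟩
    choose e he using heven
    refine ⟨∏ᶠ p : HeightOneSpectrum R, (p.asIdeal : FractionalIdeal R⁰ K) ^ e p, ?_⟩
    have hfin := FractionalIdeal.finite_factors I
    have hsupp : (Function.mulSupport fun p : HeightOneSpectrum R =>
        (p.asIdeal : FractionalIdeal R⁰ K) ^ e p).Finite := by
      refine Set.Finite.subset (Filter.eventually_cofinite.1 hfin) fun p hp hp0 => hp ?_
      have : e p = 0 := by have := he p; omega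
      simp [this]
    rw [← finprod_mul_distrib hsupp hsupp]
    conv_lhs => rw [← FractionalIdeal.finprod_heightOneSpectrum_factorization' K hI0]
    refine finprod_congr fun p => ?_
    rw [he, zpow_add₀]
    simpa using p.ne_bot
  obtain ⟨J, hJ⟩ := key
  refine ⟨J * FractionalIdeal.spanSingleton R⁰ (algebraMap R K y)⁻¹, ?_⟩
  rw [mul_mul_mul_comm, ← hJ, FractionalIdeal.spanSingleton_mul_spanSingleton,
    FractionalIdeal.spanSingleton_mul_spanSingleton]
  congr 1
  rw [map_mul]
  field_simp

/-! ### Iterates of the lift and the parity of the valuation of δ_N. -/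

theorem map_lift_iterate {R S : Type*} [CommRing R] [CommRing S] (f : R →+* S) (k : R) (n : ℕ)
    (v : R × R) : Prod.map f f ((lift k)^[n] v) = (lift (f k))^[n] (Prod.map f f v) := by
  have h : Function.Semiconj (Prod.map f f) (lift k) (lift (f k)) := by
    intro v
    simp [lift]
  exact (h.iterate_right n) v

theorem map_P {R S : Type*} [CommRing R] [CommRing S] (f : R →+* S) (k : R) (n : ℕ) (X Y : R) :
    f (P k n X Y) = P (f k) n (f X) (f Y) :=
  congrArg Prod.fst (map_lift_iterate f k n (X, Y))

theorem P_succ {R : Type*} [CommRing R] (k : R) (n : ℕ) (X Y : R) :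
    P k (n + 1) X Y = k * (((lift k)^[n] (X, Y)).1 ^ 2 + ((lift k)^[n] (X, Y)).2 ^ 2) := by
  rw [P, Function.iterate_succ_apply']
  rfl

theorem intCast_a {R : Type*} [CommRing R] (n : ℕ) : ((a n : ℤ) : R) = P 1 n 1 1 := by
  have := map_P (Int.castRingHom R) 1 n 1 1
  simpa [a] using this

/-- The second coordinate does not vanish before the first one has. -/
theorem lift_iterate_snd_ne_zero {F : Type*} [Field F] (k : F) (n : ℕ)
    (h : ∀ i, 1 ≤ i → i < n → P k i 1 1 ≠ 0) : ((lift k)^[n] (1, 1)).2 ≠ 0 := by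
  induction n with
  | zero => simp
  | succ n ih =>
    rw [Function.iterate_succ_apply']
    refine mul_ne_zero ?_ (ih fun i hi hin => h i hi (by omega))
    rcases Nat.eq_zero_or_pos n with rfl | hn
    · simp
    · exact h n hn (by omega)

theorem lift_iterate_ne_zero {F : Type*} [Field F] {k : F} (hk : k ≠ 0) (n : ℕ) :
    (lift k)^[n] (1, 1) ≠ 0 := by
  induction n with
  | zero => simp
  | succ n ih =>
    rw [Function.iterate_succ_apply']
    intro h
    obtain ⟨h1, h2⟩ := Prod.ext_iff.1 h
    simp only [lift, Prod.fst_zero, Prod.snd_zero, mul_eq_zero, hk, false_or] at h1 h2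
    apply ih
    rcases h2 with h2 | h2 <;> rw [h2] at h1
    · exact Prod.ext h2 (by simpa using h1)
    · exact Prod.ext (by simpa using h1) h2

/-- At most one of the values `P_n(1, 1)` vanishes. -/
theorem P_ne_zero_of_eq_zero {F : Type*} [Field F] {k : F} (hk : k ≠ 0) {i n : ℕ} (hin : i < n)
    (hi : P k i 1 1 = 0) : P k n 1 1 ≠ 0 := by
  have hQ : ∀ j, i < j → ((lift k)^[j] (1, 1)).2 = 0 := by
    intro j hj
    induction j, hj using Nat.le_induction with
    | base =>
      rw [Function.iterate_succ_apply']
      change P k i 1 1 * _ = 0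
      rw [hi, zero_mul]
    | succ j _ ih =>
      rw [Function.iterate_succ_apply']
      change _ * ((lift k)^[j] (1, 1)).2 = 0
      rw [ih, mul_zero]
  intro h
  exact lift_iterate_ne_zero hk n (Prod.ext h (hQ n hin))

theorem residue_ne_zero_iff {K Γ₀ : Type*} [Field K] [LinearOrderedCommGroupWithZero Γ₀]
    (v : Valuation K Γ₀) (x : v.valuationSubring) :
    IsLocalRing.residue v.valuationSubring x ≠ 0 ↔ v x = 1 := by
  rw [Ne, IsLocalRing.residue_eq_zero_iff, IsLocalRing.mem_maximalIdeal, mem_nonunits_iff, not_not]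
  exact (Valuation.integer.integers v).isUnit_iff_valuation_eq_one

/-- Modulo k, two steps of the lift for k act on (A, B) as one step of the lift for 1, up to the
factor B²: (A, B) becomes B²·(A² + B², AB). The factor t², here with t replaced by k t⁴, collects
the powers of k and stays a square. -/
theorem lift_iterate_odd {R κ : Type*} [CommRing R] [IsDomain R] [Field κ] (ρ : R →+* κ) {k : R}
    (hk : k ≠ 0) (hρ : ρ k = 0) (j : ℕ) (ha : ∀ i, 1 ≤ i → i ≤ j → P (1 : κ) i 1 1 ≠ 0) :
    ∃ t A B : R, ∃ u : κ, t ≠ 0 ∧ u ≠ 0 ∧ (lift k)^[2 * j + 1] (1, 1) = (t ^ 2 * k * A, t ^ 2 * B) ∧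
      ρ A = u * ((lift 1)^[j + 1] (1, 1)).1 ∧ ρ B = u * ((lift 1)^[j + 1] (1, 1)).2 := by
  induction j with
  | zero =>
    refine ⟨1, 2, 1, 1, one_ne_zero, one_ne_zero, ?_, ?_, ?_⟩
    · change lift k (1, 1) = _
      ext <;> simp only [lift] <;> ring
    · simp [lift, one_add_one_eq_two, map_ofNat]
    · simp [lift]
  | succ j ih =>
    obtain ⟨t, A, B, u, ht, hu, h, hA, hB⟩ := ih fun i hi hij => ha i hi (by omega)
    have hb : ((lift (1 : κ))^[j + 1] (1, 1)).2 ≠ 0 :=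
      lift_iterate_snd_ne_zero 1 (j + 1) fun i hi hij => ha i hi (by omega)
    rw [show 2 * (j + 1) + 1 = (2 * j + 1) + 1 + 1 by ring]
    rw [Function.iterate_succ_apply', Function.iterate_succ_apply', h,
      Function.iterate_succ_apply' _ (j + 1)]
    set a' := ((lift (1 : κ))^[j + 1] (1, 1)).1
    set b' := ((lift (1 : κ))^[j + 1] (1, 1)).2
    refine ⟨k * t ^ 4, (k ^ 2 * A ^ 2 + B ^ 2) ^ 2 + (A * B) ^ 2, (k ^ 2 * A ^ 2 + B ^ 2) * (A * B),
      u ^ 4 * b' ^ 2, mul_ne_zero hk (pow_ne_zero _ ht),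
      mul_ne_zero (pow_ne_zero _ hu) (pow_ne_zero _ hb), ?_, ?_, ?_⟩
    · ext <;> simp only [lift] <;> ring
    · simp only [map_add, map_mul, map_pow, hρ, hA, hB, lift]
      change _ = _ * (1 * (a' ^ 2 + b' ^ 2))
      ring
    · simp only [map_add, map_mul, map_pow, hρ, hA, hB, lift]
      change _ = _ * (a' * b')
      ring

/-- By `lift_iterate_odd`, δ_{2j+1} = (tk)²A with A reducing to a unit multiple of a_{j+1}, and
δ_{2j+2} = (t²k)²(k²A² + B²) with k²A² + B² reducing to B². The odd case is what requires a_j to be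
a unit up to 2j = N + 1. -/
theorem exists_valuation_delta_eq_sq_of_lt_one {K Γ₀ : Type*} [Field K]
    [LinearOrderedCommGroupWithZero Γ₀] (v : Valuation K Γ₀) {k : K} (hk : k ≠ 0) (hv : v k < 1)
    {N : ℕ} (hN : 1 ≤ N) (ha : ∀ j, 1 ≤ j → 2 * j ≤ N + 1 → v (a j : K) = 1) :
    ∃ c : K, v (delta k N) = v c ^ 2 := by
  let k' : v.valuationSubring := ⟨k, hv.le⟩
  let ρ := IsLocalRing.residue v.valuationSubring
  have hk' : k' ≠ 0 := fun h => hk (congrArg Subtype.val h)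
  have hρ : ρ k' = 0 := by
    by_contra h
    exact hv.ne ((residue_ne_zero_iff v k').1 h)
  have ha' : ∀ j, 1 ≤ j → 2 * j ≤ N + 1 →
      P (1 : IsLocalRing.ResidueField v.valuationSubring) j 1 1 ≠ 0 := by
    intro j hj hjN
    rw [← intCast_a, ← map_intCast ρ, residue_ne_zero_iff]
    simpa using ha j hj hjN
  have hd : ∀ n, delta k n = ((k' * P k' n 1 1 : v.valuationSubring) : K) := by
    intro n
    have := map_P v.valuationSubring.subtype k' n 1 1
    rw [delta]
    simpa [k'] using congrArg (k * ·) this.symm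
  obtain ⟨j, rfl | rfl⟩ : ∃ j, N = 2 * j + 1 ∨ N = 2 * j + 1 + 1 := ⟨(N - 1) / 2, by omega⟩
  all_goals
    obtain ⟨t, A, B, u, ht, hu, h, hA, hB⟩ :=
      lift_iterate_odd ρ hk' hρ j fun i hi hij => ha' i hi (by omega)
  · refine ⟨(t * k' : v.valuationSubring), ?_⟩
    have hA1 : v A = 1 := by
      rw [← residue_ne_zero_iff]
      change ρ A ≠ 0
      rw [hA]
      exact mul_ne_zero hu (ha' (j + 1) (by omega) (by omega))
    rw [hd, P, h, ← map_pow, show k' * (t ^ 2 * k' * A) = (t * k') ^ 2 * A by ring]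
    push_cast
    rw [map_mul, hA1, mul_one]
  · refine ⟨(t ^ 2 * k' : v.valuationSubring), ?_⟩
    have hA1 : v (k' ^ 2 * A ^ 2 + B ^ 2 : v.valuationSubring) = 1 := by
      rw [← residue_ne_zero_iff]
      change ρ _ ≠ 0
      simp only [map_add, map_mul, map_pow, hρ, hB]
      have := lift_iterate_snd_ne_zero (1 : IsLocalRing.ResidueField v.valuationSubring) (j + 1)
        fun i hi hij => ha' i hi (by omega)
      simpa only [ne_eq, OfNat.ofNat_ne_zero, not_false_eq_true, zero_pow, zero_mul, zero_add,
        pow_eq_zero_iff, mul_eq_zero, hu, false_or] using this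
    rw [hd, P_succ, h, ← map_pow,
      show k' * (k' * ((t ^ 2 * k' * A) ^ 2 + (t ^ 2 * B) ^ 2)) =
        (t ^ 2 * k') ^ 2 * (k' ^ 2 * A ^ 2 + B ^ 2) by ring]
    rw [MulMemClass.coe_mul, map_mul, hA1, mul_one]
    push_cast
    rfl

/-- When k has a pole and 2 is a unit, the first coordinate dominates the second from the first
iterate on, so δ_N has the valuation of k² times the square of the preceding first coordinate. -/
theorem exists_valuation_delta_eq_sq_of_one_lt {K Γ₀ : Type*} [Field K]
    [LinearOrderedCommGroupWithZero Γ₀] (v : Valuation K Γ₀) {k : K} (hv : 1 < v k)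
    (h2 : v 2 = 1) {N : ℕ} (hN : 2 ≤ N) : ∃ c : K, v (delta k N) = v c ^ 2 := by
  have hlt : ∀ n, v ((lift k)^[n + 1] (1, 1)).2 < v ((lift k)^[n + 1] (1, 1)).1 := by
    intro n
    induction n with
    | zero =>
      simpa [lift, show (1 + 1 : K) = 2 by norm_num, h2] using hv
    | succ n ih =>
      rw [Function.iterate_succ_apply']
      set w := (lift k)^[n + 1] (1, 1)
      have h0 : 0 < v w.1 := zero_le.trans_lt ih
      have hsq : v (w.2 ^ 2) < v (w.1 ^ 2) := by
        rw [map_pow, map_pow]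
        exact pow_lt_pow_left₀ ih zero_le two_ne_zero
      change v (w.1 * w.2) < v (k * (w.1 ^ 2 + w.2 ^ 2))
      rw [map_mul, map_mul, Valuation.map_add_eq_of_lt_left v hsq, map_pow]
      calc v w.1 * v w.2 < v w.1 * v w.1 := by gcongr
        _ = 1 * v w.1 ^ 2 := by rw [one_mul, pow_two]
        _ < v k * v w.1 ^ 2 :=
          mul_lt_mul_of_pos_right hv (zero_lt_iff.2 (pow_ne_zero 2 h0.ne'))
  obtain ⟨n, rfl⟩ : ∃ n, N = n + 1 + 1 := ⟨N - 2, by omega⟩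
  refine ⟨k * ((lift k)^[n + 1] (1, 1)).1, ?_⟩
  have hsq : v (((lift k)^[n + 1] (1, 1)).2 ^ 2) < v (((lift k)^[n + 1] (1, 1)).1 ^ 2) := by
    rw [map_pow, map_pow]
    exact pow_lt_pow_left₀ (hlt n) zero_le two_ne_zero
  rw [delta, P_succ, map_mul, map_mul, Valuation.map_add_eq_of_lt_left v hsq, map_mul, map_pow, mul_pow,
    pow_two (v k), mul_assoc]

/-- A place where `δ_N` has odd valuation is a place of good reduction for the first `N - 1`
iterates. -/
theorem valuation_eq_one_of_delta {K Γ₀ : Type*} [Field K]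
    [LinearOrderedCommGroupWithZero Γ₀] (v : Valuation K Γ₀) {k : K} (hk : k ≠ 0)
    {N : ℕ} (hN : 2 ≤ N) (ha : v k ≠ 1 → ∀ j, 1 ≤ j → 2 * j ≤ N + 1 → v (a j : K) = 1)
    (hd : ¬ ∃ c : K, v (delta k N) = v c ^ 2) :
    v k = 1 ∧ ∀ i, 1 ≤ i → i < N → v (P k i 1 1) = 1 := by
  rcases lt_trichotomy (v k) 1 with hv | hv | hv
  · exact absurd (exists_valuation_delta_eq_sq_of_lt_one v hk hv (by omega) (ha hv.ne)) hd
  · refine ⟨hv, fun i _ hiN => ?_⟩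
    let k' : v.valuationSubring := ⟨k, hv.le⟩
    let ρ := IsLocalRing.residue v.valuationSubring
    have hk' : ρ k' ≠ 0 := (residue_ne_zero_iff v k').2 hv
    have hP : ∀ n, P k n 1 1 = ((P k' n 1 1 : v.valuationSubring) : K) := by
      intro n
      have := map_P v.valuationSubring.subtype k' n 1 1
      simpa [k'] using this.symm
    have hPρ : ∀ n, ρ (P k' n 1 1) = P (ρ k') n 1 1 := by
      intro n
      rw [map_P, map_one]
    by_contra h
    rw [hP, ← residue_ne_zero_iff, not_not] at h
    -- If P_i(1,1) reduced to 0, then P_N(1,1), hence δ_N, would be a unit, against `hd`.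
    have h1 := P_ne_zero_of_eq_zero hk' hiN ((hPρ i).symm.trans h)
    rw [← hPρ] at h1
    have h2 := (residue_ne_zero_iff v _).1 h1
    rw [← hP] at h2
    exact hd ⟨1, by rw [delta, map_mul, hv, h2]; simp⟩
  · refine absurd (exists_valuation_delta_eq_sq_of_one_lt v hv ?_ hN) hd
    simpa [a, P, lift] using ha hv.ne' 1 le_rfl (by omega)

/-! ### The tree above r and the product formula for δ. -/

/-- The map `k (x + 1 / x)` on the affine line, with the junk value `0` at `0`. -/
def step {F : Type*} [Field F] (k x : F) : F :=
  k * (x + x⁻¹)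

/-- The points mapped to `r` by the `n`-th iterate of `step k`. -/
def level {F : Type*} [Field F] (k r : F) (n : ℕ) : Set F :=
  {x | (step k)^[n] x = r}

section Field

variable {F : Type*} [Field F] {k r : F}

theorem step_inv (x : F) : step k x⁻¹ = step k x := by
  rw [step, step, inv_inv, add_comm]

theorem step_neg (x : F) : step k (-x) = -step k x := by
  rw [step, step, inv_neg]
  ring

theorem step_zero : step k 0 = 0 := by
  simp [step]

theorem eq_or_eq_inv_of_step_eq (hk : k ≠ 0) {x y : F} (hx : x ≠ 0) (hy : y ≠ 0)
    (h : step k x = step k y) : x = y ∨ x = y⁻¹ := by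
  have h1 : x + x⁻¹ = y + y⁻¹ := mul_left_cancel₀ hk h
  have h2 : (x - y) * (x * y - 1) = 0 := by
    field_simp at h1
    linear_combination h1
  rcases mul_eq_zero.1 h2 with h3 | h3
  · exact Or.inl (sub_eq_zero.1 h3)
  · exact Or.inr (eq_inv_of_mul_eq_one_left (sub_eq_zero.1 h3))

theorem mem_level_zero {x : F} : x ∈ level k r 0 ↔ x = r := Iff.rfl

theorem mem_level_succ {n : ℕ} {x : F} : x ∈ level k r (n + 1) ↔ step k x ∈ level k r n := Iff.rfl

theorem ne_zero_of_mem_level (hr : r ≠ 0) {n : ℕ} {x : F} (hx : x ∈ level k r n) : x ≠ 0 := by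
  rintro rfl
  apply hr
  rw [← show (step k)^[n] 0 = r from hx]
  exact Function.iterate_fixed step_zero n

theorem level_finite (hk : k ≠ 0) (r : F) (n : ℕ) : (level k r n).Finite := by
  induction n with
  | zero => exact Set.finite_singleton r
  | succ n ih =>
    refine Set.Finite.preimage' ih fun b _ => ?_
    by_cases h : ∃ y, y ≠ 0 ∧ step k y = b
    · obtain ⟨y, hy, rfl⟩ := h
      refine (Set.toFinite {0, y, y⁻¹}).subset fun x hx => ?_
      by_cases hx0 : x = 0
      · exact Or.inl hx0
      · exact Or.inr (eq_or_eq_inv_of_step_eq hk hx0 hy hx)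
    · refine (Set.finite_singleton 0).subset fun x hx => ?_
      by_contra hx0
      exact h ⟨x, hx0, hx⟩

theorem exists_step_eq [IsAlgClosed F] (h2 : (2 : F) ≠ 0) (hk : k ≠ 0) (b : F) :
    ∃ x, x ≠ 0 ∧ step k x = b := by
  obtain ⟨s, hs⟩ := IsAlgClosed.exists_pow_nat_eq ((b / k) ^ 2 - 4) (n := 2) (by norm_num)
  have h : (b / k + s) / 2 * ((b / k - s) / 2) = 1 := by
    have : (b / k + s) / 2 * ((b / k - s) / 2) = ((b / k) ^ 2 - s ^ 2) / (2 * 2) := by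
      field_simp
      ring
    rw [this, hs]
    field_simp
    ring
  refine ⟨(b / k + s) / 2, left_ne_zero_of_mul_eq_one h, ?_⟩
  rw [step, inv_eq_of_mul_eq_one_right h]
  field_simp
  ring

/-- (q x, q) represents the point x, and the lift sends it to (q² x · step x, q² x). For r² = −1
this makes the points of level n roots of P_{n+1}(X, 1). -/
theorem lift_iterate_of_mem_level (hr : r ≠ 0) {n : ℕ} {x : F} (hx : x ∈ level k r n) (q : F) :
    ∃ q', (lift k)^[n] (q * x, q) = (q' * r, q') := by
  induction n generalizing x q with
  | zero => exact ⟨q, by rw [mem_level_zero.1 hx]; rfl⟩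
  | succ n ih =>
    obtain ⟨q', hq'⟩ := ih (mem_level_succ.1 hx) (q ^ 2 * x)
    refine ⟨q', ?_⟩
    rw [Function.iterate_succ_apply, ← hq']
    have hx0 := ne_zero_of_mem_level hr hx
    congr 1
    ext
    · simp only [lift, step]
      field_simp
    · simp only [lift]
      ring

theorem P_succ_eq_zero (hr : r ^ 2 = -1) {n : ℕ} {x : F} (hx : x ∈ level k r n) :
    P k (n + 1) x 1 = 0 := by
  have hr0 : r ≠ 0 := by
    rintro rfl
    simp at hr
  obtain ⟨q, hq⟩ := lift_iterate_of_mem_level hr0 hx 1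
  rw [one_mul] at hq
  rw [P_succ, hq]
  linear_combination k * q ^ 2 * hr

theorem lift_iterate_neg {R : Type*} [CommRing R] (k : R) (n : ℕ) (X Y : R) :
    (lift k)^[n] (X, -Y) = (((lift k)^[n] (X, Y)).1, -((lift k)^[n] (X, Y)).2) := by
  induction n generalizing X Y with
  | zero => rfl
  | succ n ih =>
    rw [Function.iterate_succ_apply, Function.iterate_succ_apply]
    have : lift k (X, -Y) = ((lift k (X, Y)).1, -(lift k (X, Y)).2) := by
      ext <;> simp [lift]
    rw [this, ih]

theorem P_succ_neg {R : Type*} [CommRing R] (k : R) (n : ℕ) (X Y : R) :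
    P k (n + 1) (-X) Y = P k (n + 1) X Y := by
  have h : lift k (-X, Y) = lift k (X, -Y) := by
    ext <;> simp [lift]
  rw [P, Function.iterate_succ_apply, h, ← Function.iterate_succ_apply, lift_iterate_neg]
  rfl

/-- x = 1/x means x = ±1, and then P_{n+1}(1,1) = 0. So fibres really have two points. -/
theorem ne_inv_of_mem_level (hr : r ^ 2 = -1) {n : ℕ} (hP : P k (n + 1) 1 1 ≠ 0) {x : F}
    (hx : x ∈ level k r n) : x ≠ x⁻¹ := by
  intro h
  have hr0 : r ≠ 0 := by
    rintro rfl
    simp at hr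
  have hx0 := ne_zero_of_mem_level hr0 hx
  have h1 : x ^ 2 = 1 := by
    rw [pow_two]
    nth_rw 2 [h]
    exact mul_inv_cancel₀ hx0
  have h2 := P_succ_eq_zero hr hx
  rcases eq_or_eq_neg_of_sq_eq_sq x 1 (by rw [h1, one_pow]) with rfl | rfl
  · exact hP h2
  · rw [P_succ_neg] at h2
    exact hP h2

theorem prod_level_succ {M : Type*} [CommMonoid M] (hk : k ≠ 0) (hr : r ≠ 0) {s : F → F}
    (hs : ∀ b, s b ≠ 0 ∧ step k (s b) = b) {n : ℕ}
    (hsep : ∀ x ∈ level k r (n + 1), x ≠ x⁻¹) (g : F → M) :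
    ∏ x ∈ (level_finite hk r (n + 1)).toFinset, g x =
      ∏ b ∈ (level_finite hk r n).toFinset, g (s b) * g (s b)⁻¹ := by
  classical
  rw [← Finset.prod_fiberwise_of_maps_to (t := (level_finite hk r n).toFinset) (g := step k)
    (by simp [mem_level_succ])]
  refine Finset.prod_congr rfl fun b hb => ?_
  rw [Set.Finite.mem_toFinset] at hb
  have hsb : s b ∈ level k r (n + 1) := by rw [mem_level_succ, (hs b).2]; exact hb
  rw [← Finset.prod_pair (hsep _ hsb)]
  refine Finset.prod_congr ?_ fun _ _ => rfl
  ext x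
  simp only [Finset.mem_filter, Set.Finite.mem_toFinset, Finset.mem_insert, Finset.mem_singleton]
  constructor
  · rintro ⟨hx, hxb⟩
    exact eq_or_eq_inv_of_step_eq hk (ne_zero_of_mem_level hr hx) (hs b).1 (hxb.trans (hs b).2.symm)
  · rintro (rfl | rfl)
    · exact ⟨hsb, (hs b).2⟩
    · rw [mem_level_succ, step_inv]
      exact ⟨hsb, (hs b).2⟩

/-- Induction through the factorisation k(X² + Y²) − bXY = k(X − s_b Y)(X − s_b⁻¹ Y). The exponent
of k is irrelevant later, since k lies in the base field. -/
theorem exists_lift_iterate_eq_prod (hk : k ≠ 0) (hr : r ≠ 0) {s : F → F}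
    (hs : ∀ b, s b ≠ 0 ∧ step k (s b) = b) {n : ℕ}
    (hsep : ∀ j ≤ n, ∀ x ∈ level k r j, x ≠ x⁻¹) :
    ∃ e : ℕ, ∀ X Y : F, ((lift k)^[n] (X, Y)).1 - r * ((lift k)^[n] (X, Y)).2 =
      k ^ e * ∏ b ∈ (level_finite hk r n).toFinset, (X - b * Y) := by
  induction n with
  | zero =>
    refine ⟨0, fun X Y => ?_⟩
    have : (level_finite hk r 0).toFinset = {r} := by
      ext x
      simp [mem_level_zero]
    rw [this]
    simp
  | succ n ih =>
    obtain ⟨e, he⟩ := ih fun j hj => hsep j (by omega)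
    refine ⟨e + (level_finite hk r n).toFinset.card, fun X Y => ?_⟩
    rw [Function.iterate_succ_apply]
    have h1 := he (lift k (X, Y)).1 (lift k (X, Y)).2
    rw [Prod.mk.eta] at h1
    rw [h1, prod_level_succ hk hr hs (hsep (n + 1) le_rfl), pow_add, mul_assoc, ← Finset.prod_const,
      ← Finset.prod_mul_distrib]
    congr 1
    refine Finset.prod_congr rfl fun b _ => ?_
    obtain ⟨h0, hb⟩ := hs b
    rw [step] at hb
    simp only [lift]
    have h3 : s b * (s b)⁻¹ = 1 := mul_inv_cancel₀ h0
    linear_combination X * Y * hb - k * Y ^ 2 * h3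

/-- `δ_{n+2}` is the square of an explicit element of the field generated by the preimages. -/
theorem exists_delta_eq_sq (hk : k ≠ 0) (hr : r ^ 2 = -1) (hr0 : r ≠ 0) {s : F → F}
    (hs : ∀ b, s b ≠ 0 ∧ step k (s b) = b) {n : ℕ}
    (hsep : ∀ j ≤ n, ∀ x ∈ level k r j, x ≠ x⁻¹) :
    ∃ e : ℕ, delta k (n + 2) =
      (k ^ e * ∏ b ∈ (level_finite hk r n).toFinset, (r * k * (s b - (s b)⁻¹))) ^ 2 := by
  obtain ⟨e, he⟩ := exists_lift_iterate_eq_prod hk hr0 hs hsep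
  refine ⟨e + 1, ?_⟩
  have h1 := he (2 * k) 1
  have h2 := he (2 * k) (-1)
  rw [lift_iterate_neg] at h2
  have h3 : (lift k)^[n + 1] (1, 1) = (lift k)^[n] (2 * k, 1) := by
    rw [Function.iterate_succ_apply]
    congr 1
    ext <;> simp only [lift] <;> ring
  rw [delta, P_succ, h3]
  set p := ((lift k)^[n] (2 * k, 1)).1
  set q := ((lift k)^[n] (2 * k, 1)).2
  -- Over r the sum of squares splits, and p + rq is the product formula evaluated at (2k, −1).
  have h4 : p ^ 2 + q ^ 2 = (p - r * q) * (p - r * -q) := by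
    linear_combination q ^ 2 * hr
  rw [h4, h1, h2, mul_pow, ← Finset.prod_pow]
  -- Factor by factor: (rk(s − 1/s))² = 4k² − k²(s + 1/s)² = (2k − b)(2k + b).
  have h5 : ∏ b ∈ (level_finite hk r n).toFinset, (r * k * (s b - (s b)⁻¹)) ^ 2 =
      (∏ b ∈ (level_finite hk r n).toFinset, (2 * k - b * 1)) *
        ∏ b ∈ (level_finite hk r n).toFinset, (2 * k - b * -1) := by
    rw [← Finset.prod_mul_distrib]
    refine Finset.prod_congr rfl fun b _ => ?_
    obtain ⟨h0, hb⟩ := hs b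
    rw [step] at hb
    have h3 : s b * (s b)⁻¹ = 1 := mul_inv_cancel₀ h0
    linear_combination k ^ 2 * (s b - (s b)⁻¹) ^ 2 * hr + 4 * k ^ 2 * h3 -
      (k * (s b + (s b)⁻¹) + b) * hb
  rw [h5]
  ring

end Field

/-! ### Extending a valuation without enlarging its value group. -/

/-- A valuation extends along a field extension, up to equivalence. -/
theorem exists_valuationSubring_extension {K E Γ₀ : Type*} [Field K] [Field E] [Algebra K E]
    [LinearOrderedCommGroupWithZero Γ₀] (v : Valuation K Γ₀) :
    ∃ B : ValuationSubring E, ∀ c : K, B.valuation (algebraMap K E c) = 1 ↔ v c = 1 := by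
  obtain ⟨B, hB, hloc⟩ :=
    (LocalSubring.map (algebraMap K E) v.valuationSubring.toLocalSubring).exists_le_valuationSubring
  have hle : ∀ c : K, v c ≤ 1 → B.valuation (algebraMap K E c) ≤ 1 := fun c hc =>
    (B.valuation_le_one_iff _).2 (hB ⟨c, hc, rfl⟩)
  have hlt : ∀ c : K, v c < 1 → B.valuation (algebraMap K E c) < 1 := by
    intro c hc
    refine lt_of_le_of_ne (hle c hc.le) fun h => ?_
    have hc0 : algebraMap K E c ≠ 0 := by
      intro h0
      simp [h0] at h
    let c' : (LocalSubring.map (algebraMap K E) v.valuationSubring.toLocalSubring).toSubring :=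
      ⟨algebraMap K E c, c, hc.le, rfl⟩
    have hu : IsUnit (Subring.inclusion hB c') := by
      refine isUnit_iff_exists_inv.2
        ⟨⟨(algebraMap K E c)⁻¹, (B.valuation_le_one_iff _).1 ?_⟩, Subtype.ext (mul_inv_cancel₀ hc0)⟩
      rw [map_inv₀, h, inv_one]
    -- The inclusion into `B` is local, so an element that becomes a unit in `B` already was one.
    obtain ⟨⟨_, d, hd, rfl⟩, h1⟩ := isUnit_iff_exists_inv.1 (hloc.1 _ hu)
    have h2 : algebraMap K E (c * d) = 1 := by
      rw [map_mul]
      exact congrArg Subtype.val h1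
    have h3 : c * d = 1 := (algebraMap K E).injective (by rw [h2, map_one])
    have h4 : v c * v d = 1 := by rw [← map_mul, h3, map_one]
    have h5 : v c * v d < 1 := mul_lt_one_of_lt_of_le hc hd
    exact h5.ne h4
  have hgt : ∀ c : K, 1 < v c → 1 < B.valuation (algebraMap K E c) := by
    intro c hc
    have h1 := hlt c⁻¹ (by rw [map_inv₀]; exact inv_lt_one_of_one_lt₀ hc)
    rw [map_inv₀, map_inv₀] at h1
    by_contra! h
    refine h1.not_ge ?_
    have h0 : B.valuation (algebraMap K E c) ≠ 0 := by
      have : c ≠ 0 := by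
        rintro rfl
        simp at hc
      simpa using this
    exact (one_le_inv₀ (zero_lt_iff.2 h0)).2 h
  refine ⟨B, fun c => ⟨fun h => ?_, fun h => ?_⟩⟩
  · rcases lt_trichotomy (v c) 1 with h1 | h1 | h1
    · exact absurd h (hlt c h1).ne
    · exact h1
    · exact absurd h (hgt c h1).ne'
  · refine le_antisymm (hle c h.le) ?_
    have h1 := hle c⁻¹ (by rw [map_inv₀, h, inv_one])
    rw [map_inv₀, map_inv₀] at h1
    by_contra! hlt'
    have h0 : B.valuation (algebraMap K E c) ≠ 0 := by
      have : c ≠ 0 := by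
        rintro rfl
        simp at h
      simpa using this
    exact h1.not_gt (one_lt_inv₀ (zero_lt_iff.2 h0) |>.2 hlt')

section

variable {K E Γ₀ : Type*} [Field K] [Field E] [Algebra K E] [LinearOrderedCommGroupWithZero Γ₀]
  {w : Valuation E Γ₀}

open IntermediateField

/-- If `K(S)` contains `x + 1 / x`, then its elements and `x - 1 / x` generate `K(S, x)`. -/
theorem exists_eq_add_mul_of_mem_adjoin_insert (h2 : (2 : E) ≠ 0) {S : Set E} {x : E} (hx0 : x ≠ 0)
    (hx : x + x⁻¹ ∈ adjoin K S) {y : E} (hy : y ∈ adjoin K (insert x S)) :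
    ∃ a ∈ adjoin K S, ∃ b ∈ adjoin K S, y = a + b * (x - x⁻¹) := by
  have hd : (x - x⁻¹) ^ 2 ∈ adjoin K S := by
    have : (x - x⁻¹) ^ 2 = (x + x⁻¹) ^ 2 - 4 := by
      field_simp
      ring
    rw [this]
    exact sub_mem (pow_mem hx 2) (ofNat_mem _ 4)
  induction hy using adjoin_induction with
  | mem y hy =>
    rcases hy with rfl | hy
    · refine ⟨2⁻¹ * (y + y⁻¹), mul_mem (inv_mem (ofNat_mem _ 2)) hx, 2⁻¹, inv_mem (ofNat_mem _ 2), ?_⟩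
      field_simp
      ring
    · exact ⟨y, subset_adjoin K S hy, 0, zero_mem _, by simp⟩
  | algebraMap c => exact ⟨_, _root_.algebraMap_mem _ c, 0, zero_mem _, by simp⟩
  | add y z _ _ hy hz =>
    obtain ⟨a, ha, b, hb, rfl⟩ := hy
    obtain ⟨a', ha', b', hb', rfl⟩ := hz
    exact ⟨a + a', add_mem ha ha', b + b', add_mem hb hb', by ring⟩
  | mul y z _ _ hy hz =>
    obtain ⟨a, ha, b, hb, rfl⟩ := hy
    obtain ⟨a', ha', b', hb', rfl⟩ := hz
    exact ⟨a * a' + b * b' * (x - x⁻¹) ^ 2, add_mem (mul_mem ha ha') (mul_mem (mul_mem hb hb') hd),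
      a * b' + a' * b, add_mem (mul_mem ha hb') (mul_mem ha' hb), by ring⟩
  | inv y _ hy =>
    obtain ⟨a, ha, b, hb, rfl⟩ := hy
    by_cases h1 : a + b * (x - x⁻¹) = 0
    · exact ⟨0, zero_mem _, 0, zero_mem _, by simp [h1]⟩
    by_cases h3 : a - b * (x - x⁻¹) = 0
    · refine ⟨(2 * a)⁻¹, inv_mem (mul_mem (ofNat_mem _ 2) ha), 0, zero_mem _, ?_⟩
      rw [← sub_eq_zero.1 h3]
      ring
    · have hN : a ^ 2 - b ^ 2 * (x - x⁻¹) ^ 2 ∈ adjoin K S :=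
        sub_mem (pow_mem ha 2) (mul_mem (pow_mem hb 2) hd)
      refine ⟨a * (a ^ 2 - b ^ 2 * (x - x⁻¹) ^ 2)⁻¹, mul_mem ha (inv_mem hN),
        -b * (a ^ 2 - b ^ 2 * (x - x⁻¹) ^ 2)⁻¹, mul_mem (neg_mem hb) (inv_mem hN), ?_⟩
      have h4 : a ^ 2 - b ^ 2 * (x - x⁻¹) ^ 2 = (a + b * (x - x⁻¹)) * (a - b * (x - x⁻¹)) := by ring
      rw [h4, mul_inv]
      calc (a + b * (x - x⁻¹))⁻¹
          = (a + b * (x - x⁻¹))⁻¹ * ((a - b * (x - x⁻¹)) * (a - b * (x - x⁻¹))⁻¹) := by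
            rw [mul_inv_cancel₀ h3, mul_one]
        _ = _ := by ring

/-- Adjoining `x` with `x - 1 / x` a unit and `x + 1 / x` already present does not enlarge the
value group, in odd residue characteristic. -/
theorem exists_valuation_eq_of_mem_adjoin_insert (h2 : w 2 = 1) {S : Set E}
    (hS : ∀ y ∈ adjoin K S, ∃ c : K, w y = w (algebraMap K E c)) {x : E} (hx0 : x ≠ 0)
    (hx : x + x⁻¹ ∈ adjoin K S) (hw : w (x - x⁻¹) = 1) :
    ∀ y ∈ adjoin K (insert x S), ∃ c : K, w y = w (algebraMap K E c) := by
  intro y hy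
  have h20 : (2 : E) ≠ 0 := by
    intro h
    simp [h] at h2
  obtain ⟨a, ha, b, hb, rfl⟩ := exists_eq_add_mul_of_mem_adjoin_insert h20 hx0 hx hy
  have hbr : w (b * (x - x⁻¹)) = w b := by rw [map_mul, hw, mul_one]
  rcases lt_trichotomy (w a) (w b) with hlt | heq | hlt
  · rw [Valuation.map_add_eq_of_lt_right w (by rwa [hbr]), hbr]
    exact hS b hb
  · by_cases hb0 : b = 0
    · exact ⟨0, by simpa [hb0] using heq⟩
    have hwb : w b ≠ 0 := by simpa using hb0
    set α := a / b with hα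
    have hαw : w α = 1 := by rw [hα, map_div₀, heq, div_self hwb]
    have hy1 : a + b * (x - x⁻¹) = b * (α + (x - x⁻¹)) := by
      rw [hα]
      field_simp
    have hle1 : w (α + (x - x⁻¹)) ≤ 1 := Valuation.map_add_le w hαw.le hw.le
    have hle2 : w (α - (x - x⁻¹)) ≤ 1 := (Valuation.map_sub w _ _).trans (max_le hαw.le hw.le)
    -- α + (x − 1/x) and α − (x − 1/x) add up to the unit 2α, so one of them is a unit. If it is the
    -- second, multiplying by it changes no valuation and turns the element into b times a norm,
    -- which lies in K(S).
    rcases hle1.lt_or_eq with h | h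
    · rcases hle2.lt_or_eq with h' | h'
      · have h3 : w (2 * α) < 1 := by
          rw [show 2 * α = (α + (x - x⁻¹)) + (α - (x - x⁻¹)) by ring]
          exact Valuation.map_add_lt w h h'
        rw [map_mul, h2, hαw, one_mul] at h3
        exact absurd h3 (lt_irrefl _)
      · have h3 : w (a + b * (x - x⁻¹)) = w (b * (α ^ 2 - ((x + x⁻¹) ^ 2 - 4))) := by
          have h4 : α ^ 2 - ((x + x⁻¹) ^ 2 - 4) = (α + (x - x⁻¹)) * (α - (x - x⁻¹)) := by
            field_simp
            ring
          rw [h4, hy1, ← mul_assoc, map_mul w _ (α - (x - x⁻¹)), h', mul_one]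
        rw [h3]
        exact hS _ (mul_mem hb (sub_mem (pow_mem (div_mem ha hb) 2)
          (sub_mem (pow_mem hx 2) (ofNat_mem _ 4))))
    · rw [hy1, map_mul, h, mul_one]
      exact hS b hb
  · rw [Valuation.map_add_eq_of_lt_left w (by rwa [hbr])]
    exact hS a ha

/-- If x were not a unit, x or 1/x would dominate x + 1/x, and the parent of x would not be a unit.
-/
theorem valuation_eq_one_of_mem_level {k r : E} (hk : w k = 1) (hr : r ^ 2 = -1) {n : ℕ} {x : E}
    (hx : x ∈ level k r n) : w x = 1 := by
  have hr1 : w r = 1 := by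
    have : w r ^ 2 = 1 := by rw [← map_pow, hr, Valuation.map_neg, map_one]
    exact (pow_eq_one_iff_of_nonneg zero_le two_ne_zero).1 this
  induction n generalizing x with
  | zero => rwa [mem_level_zero.1 hx]
  | succ n ih =>
    have hr0 : r ≠ 0 := by
      rintro rfl
      simp at hr1
    have hx0 : w x ≠ 0 := by simpa using ne_zero_of_mem_level hr0 hx
    have h1 : w (x + x⁻¹) = 1 := by
      have := ih (mem_level_succ.1 hx)
      rwa [step, map_mul, hk, one_mul] at this
    rcases lt_trichotomy (w x) 1 with h | h | h
    · have h3 : 1 < w x⁻¹ := by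
        rw [map_inv₀]
        exact (one_lt_inv₀ (zero_lt_iff.2 hx0)).2 h
      rw [Valuation.map_add_eq_of_lt_right w (h.trans h3)] at h1
      exact absurd h1 h3.ne'
    · exact h
    · have h3 : w x⁻¹ < 1 := by
        rw [map_inv₀]
        exact inv_lt_one_of_one_lt₀ h
      rw [Valuation.map_add_eq_of_lt_left w (h3.trans h)] at h1
      exact absurd h1 h.ne'

/-- x − 1/x = (x − 1)(x + 1)/x, and x ≡ ±1 would make 1 a root of the reduction of P_{n+1}(X, 1),
which is even in X. -/
theorem valuation_sub_inv_eq_one {k r : E} (hk : w k = 1) (hr : r ^ 2 = -1) {n : ℕ}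
    (hP : w (P k (n + 1) 1 1) = 1) {x : E} (hx : x ∈ level k r n) : w (x - x⁻¹) = 1 := by
  have hwx := valuation_eq_one_of_mem_level hk hr hx
  let k' : w.valuationSubring := ⟨k, hk.le⟩
  let x' : w.valuationSubring := ⟨x, hwx.le⟩
  let ρ := IsLocalRing.residue w.valuationSubring
  have hPx : P (ρ k') (n + 1) (ρ x') 1 = 0 := by
    have h1 := map_P w.valuationSubring.subtype k' (n + 1) x' 1
    have h2 : P k' (n + 1) x' 1 = 0 := Subtype.ext (h1.trans (P_succ_eq_zero hr hx))
    have h3 := map_P ρ k' (n + 1) x' 1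
    rw [h2, map_zero, map_one] at h3
    exact h3.symm
  have hP1 : P (ρ k') (n + 1) 1 1 ≠ 0 := by
    have h1 := map_P w.valuationSubring.subtype k' (n + 1) 1 1
    have h3 := map_P ρ k' (n + 1) 1 1
    rw [map_one] at h3
    rw [← h3, residue_ne_zero_iff]
    exact (congrArg w h1).trans hP
  have h1 : w (x - 1) = 1 := by
    refine (residue_ne_zero_iff w (x' - 1)).1 fun h => hP1 ?_
    rw [map_sub, map_one, sub_eq_zero] at h
    rwa [← h] at hPx ⊢
  have h2 : w (x + 1) = 1 := by
    refine (residue_ne_zero_iff w (x' + 1)).1 fun h => hP1 ?_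
    rw [map_add, map_one, ← eq_neg_iff_add_eq_zero] at h
    rwa [show ρ x' = -1 from h, P_succ_neg] at hPx
  have hx0 : x ≠ 0 := by
    rintro rfl
    simp at hwx
  have h3 : x - x⁻¹ = (x - 1) * (x + 1) * x⁻¹ := by
    field_simp
    ring
  rw [h3, map_mul, map_mul, h1, h2, map_inv₀, hwx]
  simp

/-- The vertices up to level `n`. -/
def ball {F : Type*} [Field F] (k r : F) (n : ℕ) : Set F :=
  {x | ∃ j ≤ n, x ∈ level k r j}

theorem ball_succ {F : Type*} [Field F] (k r : F) (n : ℕ) :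
    ball k r (n + 1) = ball k r n ∪ level k r (n + 1) := by
  ext x
  constructor
  · rintro ⟨j, hj, hx⟩
    rcases hj.lt_or_eq with h | rfl
    · exact Or.inl ⟨j, by omega, hx⟩
    · exact Or.inr hx
  · rintro (⟨j, hj, hx⟩ | hx)
    · exact ⟨j, by omega, hx⟩
    · exact ⟨n + 1, le_rfl, hx⟩

/-- At a place of good reduction, the field generated by the tree is unramified. -/
theorem exists_valuation_eq_of_mem_adjoin_ball (h2 : w 2 = 1) {k : K} {r : E} (hr : r ^ 2 = -1)
    (hk : w (algebraMap K E k) = 1) {n : ℕ}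
    (hP : ∀ j, 1 ≤ j → j ≤ n + 1 → w (P (algebraMap K E k) j 1 1) = 1) :
    ∀ y ∈ adjoin K (ball (algebraMap K E k) r n), ∃ c : K, w y = w (algebraMap K E c) := by
  have hk0 : algebraMap K E k ≠ 0 := by
    intro h
    simp [h] at hk
  have hr0 : r ≠ 0 := by
    rintro rfl
    simp at hr
  induction n with
  | zero =>
    have : ball (algebraMap K E k) r 0 = insert r ∅ := by
      ext x
      simp [ball, mem_level_zero]
    rw [this]
    refine exists_valuation_eq_of_mem_adjoin_insert h2 ?_ hr0 ?_
      (valuation_sub_inv_eq_one hk hr (hP 1 le_rfl le_rfl) (mem_level_zero.2 rfl))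
    · intro y hy
      rw [adjoin_empty, mem_bot] at hy
      obtain ⟨c, rfl⟩ := hy
      exact ⟨c, rfl⟩
    · have : r + r⁻¹ = 0 := by
        field_simp
        rw [hr]
        ring
      rw [this]
      exact zero_mem _
  | succ n ih =>
    have ih' := ih fun j hj hjn => hP j hj (by omega)
    rw [ball_succ]
    -- The points of level n + 1 are adjoined one at a time.
    have key : ∀ T : Set E, T.Finite → T ⊆ level (algebraMap K E k) r (n + 1) →
        ∀ y ∈ adjoin K (ball (algebraMap K E k) r n ∪ T), ∃ c : K, w y = w (algebraMap K E c) := by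
      intro T hT
      induction T, hT using Set.Finite.induction_on with
      | empty =>
        intro _
        rwa [Set.union_empty]
      | @insert x T _ _ ihT =>
        intro hsub
        rw [Set.union_insert]
        have hx := hsub (Set.mem_insert x T)
        refine exists_valuation_eq_of_mem_adjoin_insert h2
          (ihT ((Set.subset_insert x T).trans hsub)) (ne_zero_of_mem_level hr0 hx) ?_
          (valuation_sub_inv_eq_one hk hr (hP _ (by omega) le_rfl) hx)
        have h1 : x + x⁻¹ = (algebraMap K E k)⁻¹ * step (algebraMap K E k) x := by
          rw [step, inv_mul_cancel_left₀ hk0]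
        rw [h1]
        exact mul_mem (inv_mem (_root_.algebraMap_mem _ k))
          (subset_adjoin K _ (Or.inl ⟨n, le_rfl, mem_level_succ.1 hx⟩))
    exact key _ (level_finite hk0 r (n + 1)) subset_rfl

end

/-! ### The Galois action on the tree above r, level by level. -/

section Galois

open IntermediateField

variable {K E : Type*} [Field K] [Field E] [Algebra K E] {k : K} {r : E}

theorem step_algEquiv (σ : E ≃ₐ[K] E) (x : E) :
    step (algebraMap K E k) (σ x) = σ (step (algebraMap K E k) x) := by
  simp [step]

theorem algEquiv_mem_level {σ : E ≃ₐ[K] E} (hσ : σ r = r) {n : ℕ} {x : E}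
    (hx : x ∈ level (algebraMap K E k) r n) : σ x ∈ level (algebraMap K E k) r n := by
  have h : Function.Semiconj σ (step (algebraMap K E k)) (step (algebraMap K E k)) :=
    fun y => (step_algEquiv σ y).symm
  have h1 := (h.iterate_right n) x
  rw [show (step (algebraMap K E k))^[n] x = r from hx, hσ] at h1
  exact h1.symm

theorem algEquiv_mem_ball {σ : E ≃ₐ[K] E} (hσ : σ r = r) {n : ℕ} {x : E}
    (hx : x ∈ ball (algebraMap K E k) r n) : σ x ∈ ball (algebraMap K E k) r n := by
  obtain ⟨j, hj, hx⟩ := hx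
  exact ⟨j, hj, algEquiv_mem_level hσ hx⟩

theorem algEquiv_eq_or_eq_inv (hk : k ≠ 0) {σ : E ≃ₐ[K] E} {x : E} (hx : x ≠ 0)
    (hσ : σ (step (algebraMap K E k) x) = step (algebraMap K E k) x) : σ x = x ∨ σ x = x⁻¹ := by
  refine eq_or_eq_inv_of_step_eq (k := algebraMap K E k) (by simpa using hk) (by simpa using hx) hx ?_
  rw [step_algEquiv, hσ]

/-- A power of σ that fixes the parent of x sends x to x or 1/x, so its square fixes x. Thus the
stabilizer of r acts on each level through a 2-group. -/
theorem algEquiv_pow_two_pow (hk : k ≠ 0) (hr : r ≠ 0) {σ : E ≃ₐ[K] E} (hσ : σ r = r) {n : ℕ}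
    {x : E} (hx : x ∈ level (algebraMap K E k) r n) : (σ ^ 2 ^ n) x = x := by
  induction n generalizing x with
  | zero => rw [mem_level_zero.1 hx, pow_zero, pow_one, hσ]
  | succ n ih =>
    rw [pow_succ, pow_mul, pow_two, AlgEquiv.mul_apply]
    rcases algEquiv_eq_or_eq_inv hk (ne_zero_of_mem_level hr hx) (ih (mem_level_succ.1 hx))
      with h | h
    · rw [h, h]
    · rw [h, map_inv₀, h, inv_inv]

/-- The fixer of the levels up to `n` acts on level `n + 1` by all permutations preserving the
fibres over level `n`. -/
def IsFullAt (k : K) (r : E) (n : ℕ) : Prop :=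
  ∀ flip : E → Prop, ∃ τ : E ≃ₐ[K] E, (∀ x ∈ ball (algebraMap K E k) r n, τ x = x) ∧
    ∀ x ∈ level (algebraMap K E k) r (n + 1),
      (flip (step (algebraMap K E k) x) → τ x = x⁻¹) ∧
        (¬ flip (step (algebraMap K E k) x) → τ x = x)

/-- The stabilizer of the root acts transitively on level `n`. -/
def IsTransitiveAt (k : K) (r : E) (n : ℕ) : Prop :=
  ∀ x ∈ level (algebraMap K E k) r n, ∀ y ∈ level (algebraMap K E k) r n,
    ∃ σ : E ≃ₐ[K] E, σ r = r ∧ σ x = y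

theorem root_mem_ball (k r : E) (n : ℕ) : r ∈ ball k r n :=
  ⟨0, Nat.zero_le n, mem_level_zero.2 rfl⟩

/-- Once the parents are matched, the image of x is y or 1/y; in the latter case flip all fibres. -/
theorem IsTransitiveAt.succ (hk : k ≠ 0) (hr : r ≠ 0) {n : ℕ} (ht : IsTransitiveAt k r n)
    (hf : IsFullAt k r n) : IsTransitiveAt k r (n + 1) := by
  intro x hx y hy
  obtain ⟨σ, hσ, hxy⟩ := ht _ (mem_level_succ.1 hx) _ (mem_level_succ.1 hy)
  have hk' : algebraMap K E k ≠ 0 := by simpa using hk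
  have hx0 : σ x ≠ 0 := by simpa using ne_zero_of_mem_level hr hx
  rw [← step_algEquiv] at hxy
  rcases eq_or_eq_inv_of_step_eq hk' hx0 (ne_zero_of_mem_level hr hy) hxy with h | h
  · exact ⟨σ, hσ, h⟩
  · obtain ⟨τ, hτ, hτ'⟩ := hf fun _ => True
    refine ⟨τ * σ, ?_, ?_⟩
    · rw [AlgEquiv.mul_apply, hσ, hτ r (root_mem_ball _ r n)]
    · rw [AlgEquiv.mul_apply, h, map_inv₀, (hτ' y hy).1 trivial, inv_inv]

/-- If all levels are full then every automorphism of the tree is realised by the Galois group. -/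
theorem exists_algEquiv_of_isFullAt [IsAlgClosed E] (h2 : (2 : E) ≠ 0) (hk : k ≠ 0) (hr : r ≠ 0)
    {n : ℕ} (hf : ∀ j < n, IsFullAt k r j) {c : E → E} (hc0 : c r = r)
    (hcs : ∀ j < n, ∀ x ∈ level (algebraMap K E k) r (j + 1),
      step (algebraMap K E k) (c x) = c (step (algebraMap K E k) x))
    (hci : ∀ j < n, ∀ x ∈ level (algebraMap K E k) r (j + 1), c x⁻¹ = (c x)⁻¹) :
    ∃ σ : E ≃ₐ[K] E, ∀ x ∈ ball (algebraMap K E k) r n, σ x = c x := by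
  have hk' : algebraMap K E k ≠ 0 := by simpa using hk
  induction n with
  | zero =>
    refine ⟨1, ?_⟩
    rintro x ⟨j, hj, hx⟩
    obtain rfl : j = 0 := by omega
    rw [mem_level_zero.1 hx, hc0]
    rfl
  | succ n ih =>
    obtain ⟨σ, hσ⟩ := ih (fun j hj => hf j (by omega)) (fun j hj => hcs j (by omega))
      (fun j hj => hci j (by omega))
    choose s hs0 hs using exists_step_eq (F := E) h2 hk'
    -- Flip exactly the fibres on which σ, correct up to level n, disagrees with c.
    obtain ⟨τ, hτ, hτ'⟩ := hf n (by omega) fun b => σ (s b) ≠ c (s b)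
    refine ⟨σ * τ, ?_⟩
    rw [ball_succ]
    rintro x (hx | hx)
    · rw [AlgEquiv.mul_apply, hτ x hx, hσ x hx]
    have key : ∀ b ∈ level (algebraMap K E k) r n, (σ * τ) (s b) = c (s b) := by
      intro b hb
      have hsb : s b ∈ level (algebraMap K E k) r (n + 1) := by rwa [mem_level_succ, hs]
      have hτb := hτ' _ hsb
      rw [hs] at hτb
      rw [AlgEquiv.mul_apply]
      by_cases h : σ (s b) = c (s b)
      · rw [hτb.2 (not_not.2 h), h]
      · rw [hτb.1 h, map_inv₀]
        have h1 : step (algebraMap K E k) (c (s b)) = step (algebraMap K E k) (σ (s b)) := by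
          rw [hcs n (by omega) _ hsb, step_algEquiv, hs, hσ b ⟨n, le_rfl, hb⟩]
        have hc : c (s b) ≠ 0 := by
          intro h0
          rw [h0, step_zero, step_algEquiv, hs] at h1
          exact ne_zero_of_mem_level hr hb (by simpa using h1.symm)
        rcases eq_or_eq_inv_of_step_eq hk' hc (by simpa using hs0 b) h1 with h3 | h3
        · exact absurd h3.symm h
        · exact h3.symm
    have hb := mem_level_succ.1 hx
    rcases eq_or_eq_inv_of_step_eq hk' (ne_zero_of_mem_level hr hx) (hs0 _) (hs _).symm with h | h
    · rw [h]
      exact key _ hb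
    · rw [h, hci n (by omega), map_inv₀, key _ hb]
      rwa [mem_level_succ, hs]

open scoped Classical in
/-- Whether `τ` moves `x`, as an element of `𝔽₂`. -/
noncomputable def moves (τ : E ≃ₐ[K] E) (x : E) : ZMod 2 :=
  if τ x = x then 0 else 1

theorem moves_eq_zero_iff {τ : E ≃ₐ[K] E} {x : E} : moves τ x = 0 ↔ τ x = x := by
  unfold moves
  split_ifs with h <;> simp [h]

theorem moves_eq_moves {τ τ' : E ≃ₐ[K] E} {x x' : E} (h : τ x = x ↔ τ' x' = x') :
    moves τ x = moves τ' x' := by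
  unfold moves
  by_cases h1 : τ x = x
  · rw [if_pos h1, if_pos (h.1 h1)]
  · rw [if_neg h1, if_neg (mt h.2 h1)]

theorem moves_mul {σ τ : E ≃ₐ[K] E} {x : E} (hx : x ≠ x⁻¹) (hσ : σ x = x ∨ σ x = x⁻¹)
    (hτ : τ x = x ∨ τ x = x⁻¹) : moves (σ * τ) x = moves σ x + moves τ x := by
  unfold moves
  rw [AlgEquiv.mul_apply]
  rcases hσ with hσ | hσ <;> rcases hτ with hτ | hτ <;>
    simp [hσ, hτ, hx.symm, CharTwo.add_self_eq_zero]

theorem algEquiv_sub_inv {τ : E ≃ₐ[K] E} {x : E} (hx : x ≠ x⁻¹) (hτ : τ x = x ∨ τ x = x⁻¹) :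
    τ (x - x⁻¹) = (-1) ^ (moves τ x).val * (x - x⁻¹) := by
  rcases hτ with h | h
  · simp [moves, h]
  · simp [moves, h, hx.symm, ZMod.val_one]

/-- Level `n + 1` is full over level `n` as soon as the product of the square roots of the
discriminants is not rational over the field generated by level `n`. -/
theorem IsTransitiveAt.isFullAt [IsGalois K E] (hk : k ≠ 0) (hr : r ≠ 0) {s : E → E}
    (hs : ∀ b, s b ≠ 0 ∧ step (algebraMap K E k) (s b) = b) {n : ℕ}
    (hsep : ∀ x ∈ level (algebraMap K E k) r (n + 1), x ≠ x⁻¹) (ht : IsTransitiveAt k r n)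
    (hk' : algebraMap K E k ≠ 0)
    (hD : ∏ b ∈ (level_finite hk' r n).toFinset, (s b - (s b)⁻¹) ∉
      adjoin K (ball (algebraMap K E k) r n)) : IsFullAt k r n := by
  classical
  set S := level (algebraMap K E k) r n
  have : Fintype S := (level_finite hk' r n).fintype
  have hsS : ∀ b ∈ S, s b ∈ level (algebraMap K E k) r (n + 1) := by
    intro b hb
    rwa [mem_level_succ, (hs b).2]
  have hfib : ∀ x ≠ 0, x = s (step (algebraMap K E k) x) ∨ x = (s (step (algebraMap K E k) x))⁻¹ :=
    fun x hx => eq_or_eq_inv_of_step_eq hk' hx (hs _).1 (hs _).2.symm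
  let N : Subgroup (E ≃ₐ[K] E) := fixingSubgroup (E ≃ₐ[K] E) (ball (algebraMap K E k) r n)
  have hN : ∀ τ, τ ∈ N ↔ ∀ x ∈ ball (algebraMap K E k) r n, τ x = x := fun τ =>
    mem_fixingSubgroup_iff _
  have hNs : ∀ τ ∈ N, ∀ b ∈ S, τ (s b) = s b ∨ τ (s b) = (s b)⁻¹ := by
    intro τ hτ b hb
    refine algEquiv_eq_or_eq_inv hk (hs b).1 ?_
    rw [(hs b).2]
    exact (hN τ).1 hτ b ⟨n, le_rfl, hb⟩
  let Q := MulAction.stabilizer (E ≃ₐ[K] E) r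
  have hQ : ∀ g : Q, g.1 r = r := fun g => g.2
  let act : MulAction Q S :=
    { smul := fun g b => ⟨g.1 b, algEquiv_mem_level (hQ g) b.2⟩
      one_smul := fun b => rfl
      mul_smul := fun g h b => rfl }
  have htrans : MulAction.IsPretransitive Q S := ⟨fun x y => by
    obtain ⟨σ, hσ, h⟩ := ht x x.2 y y.2
    exact ⟨⟨σ, hσ⟩, Subtype.ext h⟩⟩
  -- The flip patterns on level n + 1 of the elements fixing all lower levels.
  let W : AddSubgroup (S → ZMod 2) :=
    { carrier := {ε | ∃ τ ∈ N, ∀ b : S, ε b = moves τ (s b)}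
      zero_mem' := ⟨1, one_mem N, fun b => (moves_eq_zero_iff.2 rfl).symm⟩
      add_mem' := by
        rintro ε ε' ⟨τ, hτ, h⟩ ⟨τ', hτ', h'⟩
        refine ⟨τ * τ', mul_mem hτ hτ', fun b => ?_⟩
        rw [moves_mul (hsep _ (hsS b b.2)) (hNs τ hτ b b.2) (hNs τ' hτ' b b.2), ← h, ← h']
        rfl
      neg_mem' := by
        rintro ε ⟨τ, hτ, h⟩
        refine ⟨τ, hτ, fun b => ?_⟩
        rw [← h, Pi.neg_apply, CharTwo.neg_eq] }
  have hWQ : ∀ g : Q, ∀ ε ∈ W, (fun b => ε (g⁻¹ • b)) ∈ W := by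
    rintro g ε ⟨τ, hτ, h⟩
    -- Conjugation by g transports the flip pattern. g⁻¹ need not respect the section s, but τ moves
    -- both points of a fibre or neither.
    refine ⟨g.1 * τ * g.1⁻¹, (hN _).2 fun x hx => ?_, fun b => ?_⟩
    · have h1 := (hN τ).1 hτ _ (algEquiv_mem_ball (hQ g⁻¹) hx)
      have h2 : (g⁻¹ : Q).1 = g.1⁻¹ := rfl
      rw [h2] at h1
      rw [AlgEquiv.mul_apply, AlgEquiv.mul_apply, h1]
      exact g.1.apply_symm_apply x
    · change ε (g⁻¹ • b) = _
      rw [h]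
      refine moves_eq_moves ?_
      have h3 : (g.1 * τ * g.1⁻¹) (s b) = s b ↔ τ (g.1⁻¹ (s b)) = g.1⁻¹ (s b) := by
        rw [AlgEquiv.mul_apply, AlgEquiv.mul_apply]
        exact g.1.toEquiv.eq_symm_apply.symm
      have h4 : step (algebraMap K E k) (g.1⁻¹ (s b)) = ((g⁻¹ • b : S) : E) := by
        rw [step_algEquiv, (hs _).2]
        rfl
      have h5 := hfib (g.1⁻¹ (s b)) (by simpa using (hs b).1)
      rw [h4] at h5
      rw [h3]
      rcases h5 with h5 | h5
      · rw [h5]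
      · rw [h5, map_inv₀, inv_inj]
  have hsum : ∃ ε ∈ W, ∑ b, ε b ≠ 0 := by
    by_contra! hall
    apply hD
    set D := ∏ b ∈ (level_finite hk' r n).toFinset, (s b - (s b)⁻¹) with hDdef
    -- τ multiplies D by −1 to the number of flipped fibres, here even.
    have hfix : ∀ τ ∈ N, τ D = D := by
      intro τ hτ
      have h0 : ∑ b : S, moves τ (s b) = 0 := hall _ ⟨τ, hτ, fun b => rfl⟩
      have h1 : Even (∑ b : S, (moves τ (s b)).val) := by
        rw [← ZMod.natCast_eq_zero_iff_even]
        push_cast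
        simpa using h0
      have h2 : D = ∏ b : S, (s b - (s b)⁻¹) := by
        rw [hDdef]
        exact Finset.prod_subtype _ (fun x => Set.Finite.mem_toFinset _) fun b => s b - (s b)⁻¹
      have h3 : ∏ b : S, τ (s b - (s b)⁻¹) =
          ∏ b : S, (-1) ^ (moves τ (s b)).val * (s b - (s b)⁻¹) :=
        Finset.prod_congr rfl fun b _ => algEquiv_sub_inv (hsep _ (hsS b b.2)) (hNs τ hτ b b.2)
      rw [h2, map_prod, h3, Finset.prod_mul_distrib, Finset.prod_pow_eq_pow_sum, h1.neg_one_pow, one_mul]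
    have hmem := (InfiniteGalois.mem_range_algebraMap_iff_fixed
      (k := adjoin K (ball (algebraMap K E k) r n)) (K := E) D).2 fun σ => hfix (σ.restrictScalars K)
        ((hN _).2 fun x hx => σ.commutes ⟨x, subset_adjoin K _ hx⟩)
    obtain ⟨y, hy⟩ := hmem
    rw [← hy]
    exact y.2
  obtain ⟨ε₀, hε₀, hsum⟩ := hsum
  have htop : W = ⊤ := eq_top_of_sum_ne_zero (Q := Q)
    (fun g => ⟨n, fun b => Subtype.ext (algEquiv_pow_two_pow hk hr (hQ g) b.2)⟩) W hWQ hε₀ hsum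
  intro flip
  obtain ⟨τ, hτ, h⟩ : (fun b : S => if flip b then (1 : ZMod 2) else 0) ∈ W := by
    rw [htop]
    trivial
  refine ⟨τ, (hN τ).1 hτ, fun x hx => ?_⟩
  have key : (flip (step (algebraMap K E k) x) ↔ τ x ≠ x) := by
    have h1 := h ⟨_, mem_level_succ.1 hx⟩
    have h2 : τ x = x ↔ τ (s (step (algebraMap K E k) x)) = s (step (algebraMap K E k) x) := by
      rcases hfib x (ne_zero_of_mem_level hr hx) with h5 | h5
      · rw [← h5]
      · nth_rw 1 2 [h5]
        rw [map_inv₀, inv_inj]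
    rw [Ne, h2, ← moves_eq_zero_iff, ← h1]
    change _ ↔ ¬ (if flip (step (algebraMap K E k) x) then (1 : ZMod 2) else 0) = 0
    split_ifs with h3 <;> simp [h3]
  refine ⟨fun hf => ?_, fun hf => not_not.1 (mt key.2 hf)⟩
  refine (algEquiv_eq_or_eq_inv hk (ne_zero_of_mem_level hr hx) ?_).resolve_left (key.1 hf)
  exact (hN τ).1 hτ _ ⟨n, le_rfl, mem_level_succ.1 hx⟩

end Galois

/-! ### The arithmetic input over a number field. -/

section NumberField

variable {K : Type*} [Field K] [NumberField K] {k : K} {m : ℕ}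

/-- The zero ideal is a square, so δ_n ≠ 0 for 2 ≤ n ≤ m; and P_1(1,1) = 2k. -/
theorem P_ne_zero_of_not_isSquare (hk : k ≠ 0)
    (hdelta : ∀ n : ℕ, 2 ≤ n → n ≤ m →
      ¬ IsSquare (FractionalIdeal.spanSingleton (𝓞 K)⁰ (delta k n) : FractionalIdeal (𝓞 K)⁰ K))
    {n : ℕ} (hn : 1 ≤ n) (hnm : n ≤ m) : P k n 1 1 ≠ 0 := by
  intro h
  rcases hn.lt_or_eq with h1 | rfl
  · apply hdelta n h1 hnm
    rw [delta, h, mul_zero, FractionalIdeal.spanSingleton_zero]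
    exact IsSquare.zero
  · have h2 : P k 1 1 1 = k * 2 := by
      rw [P_succ]
      simp [one_add_one_eq_two]
    rw [h2] at h
    exact mul_ne_zero hk two_ne_zero h

variable {E : Type*} [Field E] [Algebra K E] {r : E}

theorem ne_inv_of_not_isSquare (hk : k ≠ 0)
    (hdelta : ∀ n : ℕ, 2 ≤ n → n ≤ m →
      ¬ IsSquare (FractionalIdeal.spanSingleton (𝓞 K)⁰ (delta k n) : FractionalIdeal (𝓞 K)⁰ K))
    (hr : r ^ 2 = -1) {j : ℕ} (hj : j + 1 ≤ m) {x : E} (hx : x ∈ level (algebraMap K E k) r j) :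
    x ≠ x⁻¹ := by
  refine ne_inv_of_mem_level hr ?_ hx
  have h := map_P (algebraMap K E) k (j + 1) 1 1
  rw [map_one] at h
  rw [← h]
  simpa using P_ne_zero_of_not_isSquare hk hdelta (Nat.le_add_left 1 j) hj

/-- Otherwise δ_{n+2} would be a square in a field with the same value group as K at a prime where
its valuation is odd. -/
theorem prod_notMem_adjoin_ball (hk : k ≠ 0)
    (hdelta : ∀ n : ℕ, 2 ≤ n → n ≤ m →
      ¬ IsSquare (FractionalIdeal.spanSingleton (𝓞 K)⁰ (delta k n) : FractionalIdeal (𝓞 K)⁰ K))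
    (hunit : ∀ n : ℕ, 1 ≤ n → (n : ℚ) < (m : ℚ) / 2 + 1 →
      ∀ p : IsDedekindDomain.HeightOneSpectrum (𝓞 K),
        p.asIdeal ∣ Ideal.span {((a n : ℤ) : 𝓞 K)} → p.valuation K k = 1)
    (hr : r ^ 2 = -1) (hk' : algebraMap K E k ≠ 0) {s : E → E}
    (hs : ∀ b, s b ≠ 0 ∧ step (algebraMap K E k) (s b) = b) {n : ℕ} (hn : n + 2 ≤ m) :
    ∏ b ∈ (level_finite hk' r n).toFinset, (s b - (s b)⁻¹) ∉
      IntermediateField.adjoin K (ball (algebraMap K E k) r n) := by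
  intro hD
  have hr0 : r ≠ 0 := by
    rintro rfl
    simp at hr
  obtain ⟨p, hp⟩ : ∃ p : IsDedekindDomain.HeightOneSpectrum (𝓞 K),
      ¬ ∃ c : K, p.valuation K (delta k (n + 2)) = p.valuation K c ^ 2 := by
    by_contra! h
    exact hdelta (n + 2) (by omega) hn (isSquare_spanSingleton _ h)
  obtain ⟨hvk, hvP⟩ := valuation_eq_one_of_delta (p.valuation K) hk (by omega) (fun hvk j hj hjn => by
    have hcast : ((a j : ℤ) : K) = algebraMap (𝓞 K) K ((a j : ℤ) : 𝓞 K) := by simp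
    by_contra h
    refine hvk (hunit j hj ?_ p ?_)
    -- 2j ≤ (n + 2) + 1 ≤ m + 1 is where the range j < m/2 + 1 is used.
    · have : (2 * j : ℚ) ≤ m + 1 := by exact_mod_cast (by omega : 2 * j ≤ m + 1)
      linarith
    · rw [hcast] at h
      exact (p.valuation_lt_one_iff_dvd _).1 (lt_of_le_of_ne (p.valuation_le_one _) h)) hp
  have hv2 : p.valuation K 2 = 1 := by
    have h1 := hvP 1 le_rfl (by omega)
    have h2 : P k 1 1 1 = k * 2 := by
      rw [P_succ]
      simp [one_add_one_eq_two]
    rwa [h2, map_mul, hvk, one_mul] at h1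
  obtain ⟨B, hB⟩ := exists_valuationSubring_extension (E := E) (p.valuation K)
  have hw2 : B.valuation 2 = 1 := by
    have := (hB 2).2 hv2
    rwa [map_ofNat] at this
  have hwP : ∀ j, 1 ≤ j → j ≤ n + 1 → B.valuation (P (algebraMap K E k) j 1 1) = 1 := by
    intro j hj hjn
    have h := map_P (algebraMap K E) k j 1 1
    rw [map_one] at h
    rw [← h]
    exact (hB _).2 (hvP j hj (by omega))
  obtain ⟨e, he⟩ := exists_delta_eq_sq hk' hr hr0 hs (n := n)
    fun j hj x hx => ne_inv_of_not_isSquare hk hdelta hr (by omega) hx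
  set t := algebraMap K E k ^ e *
    ∏ b ∈ (level_finite hk' r n).toFinset, (r * algebraMap K E k * (s b - (s b)⁻¹)) with ht
  have htmem : t ∈ IntermediateField.adjoin K (ball (algebraMap K E k) r n) := by
    rw [ht, Finset.prod_mul_distrib, Finset.prod_const]
    have hkm := (IntermediateField.adjoin K (ball (algebraMap K E k) r n)).algebraMap_mem k
    exact mul_mem (pow_mem hkm e) (mul_mem (pow_mem (mul_mem
      (IntermediateField.subset_adjoin K _ (root_mem_ball _ r n)) hkm) _) hD)
  obtain ⟨c, hc⟩ := exists_valuation_eq_of_mem_adjoin_ball hw2 hr ((hB k).2 hvk) hwP t htmem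
  have hmap : algebraMap K E (delta k (n + 2)) = t ^ 2 := by
    rw [← he, delta, delta, map_mul, map_P, map_one]
  have hd0 : delta k (n + 2) ≠ 0 :=
    mul_ne_zero hk (P_ne_zero_of_not_isSquare hk hdelta (by omega) hn)
  have ht0 : t ≠ 0 := by
    rintro h
    rw [h, zero_pow two_ne_zero] at hmap
    exact hd0 (by simpa using hmap)
  have hwt : B.valuation t ≠ 0 := by simpa using ht0
  have hc0 : p.valuation K c ≠ 0 := by
    intro h
    have h1 : c = 0 := by simpa using h
    rw [h1, map_zero, map_zero] at hc
    exact hwt hc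
  refine hp ⟨c, ?_⟩
  -- The extended valuation is comparable with that of K only through the value 1, so the quotient
  -- by c² is tested.
  have h1 : p.valuation K (delta k (n + 2) / c ^ 2) = 1 := by
    rw [← hB, map_div₀, map_pow, hmap, map_div₀, map_pow, map_pow, hc, div_self]
    rw [← hc]
    exact pow_ne_zero 2 hwt
  rw [map_div₀, map_pow] at h1
  exact (div_eq_one_iff_eq (pow_ne_zero 2 hc0)).1 h1

/-- Transitivity and fullness are proved alternately: transitivity on level j gives fullness over
it, and both give transitivity on level j + 1. -/
theorem isFullAt_of_not_isSquare [IsAlgClosed E] [IsGalois K E] (hk : k ≠ 0)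
    (hdelta : ∀ n : ℕ, 2 ≤ n → n ≤ m →
      ¬ IsSquare (FractionalIdeal.spanSingleton (𝓞 K)⁰ (delta k n) : FractionalIdeal (𝓞 K)⁰ K))
    (hunit : ∀ n : ℕ, 1 ≤ n → (n : ℚ) < (m : ℚ) / 2 + 1 →
      ∀ p : IsDedekindDomain.HeightOneSpectrum (𝓞 K),
        p.asIdeal ∣ Ideal.span {((a n : ℤ) : 𝓞 K)} → p.valuation K k = 1)
    (hr : r ^ 2 = -1) {n : ℕ} (hn : n + 2 ≤ m) : IsFullAt k r n := by
  have hr0 : r ≠ 0 := by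
    rintro rfl
    simp at hr
  have hk' : algebraMap K E k ≠ 0 := by simpa using hk
  have h2 : (2 : E) ≠ 0 := by
    rw [← map_ofNat (algebraMap K E) 2]
    simp
  choose s hs using exists_step_eq (F := E) h2 hk'
  have key : ∀ j, j + 2 ≤ m → IsTransitiveAt k r j → IsFullAt k r j := fun j hj ht =>
    ht.isFullAt hk hr0 hs (fun x hx => ne_inv_of_not_isSquare hk hdelta hr hj hx) hk'
      (prod_notMem_adjoin_ball hk hdelta hunit hr hk' hs hj)
  have htr : ∀ j, j + 1 ≤ m → IsTransitiveAt k r j := by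
    intro j
    induction j with
    | zero =>
      intro _ x hx y hy
      exact ⟨1, rfl, (mem_level_zero.1 hx).trans (mem_level_zero.1 hy).symm⟩
    | succ j ih =>
      intro hj
      exact (ih (by omega)).succ hk hr0 (key j hj (ih (by omega)))
  exact key n hn (htr n (by omega))

end NumberField

/-! ### From the two half trees to T_m. -/

section Projective

variable {F : Type*} [Field F] {k r : F}

theorem phi_coe_of_ne_zero {x : F} (hx : x ≠ 0) :
    phi k (x : OnePoint F) = ((step k x : F) : OnePoint F) := by
  have : k * (x ^ 2 + 1) / x = step k x := by
    rw [step]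
    field_simp
  simp [phi, hx, this]

theorem phi_zero : phi k ((0 : F) : OnePoint F) = OnePoint.infty := by
  simp [phi]

theorem phi_infty : phi k OnePoint.infty = OnePoint.infty := by
  simp [phi]

theorem infty_notMem_V (n : ℕ) : OnePoint.infty ∉ V k n := by
  intro h
  have h1 : (phi k)^[n] OnePoint.infty = OnePoint.infty := Function.iterate_fixed phi_infty n
  exact OnePoint.infty_ne_coe _ (h1.symm.trans h)

theorem mem_V_succ {n : ℕ} {z : OnePoint F} : z ∈ V k (n + 1) ↔ phi k z ∈ V k n := Iff.rfl

theorem mem_V_zero {z : OnePoint F} : z ∈ V k 0 ↔ z = ((0 : F) : OnePoint F) := Iff.rfl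

theorem step_eq_zero_iff (hk : k ≠ 0) (hr : r ^ 2 = -1) {x : F} (hx : x ≠ 0) :
    step k x = 0 ↔ x = r ∨ x = -r := by
  have h : step k x = 0 ↔ x ^ 2 = r ^ 2 := by
    rw [step, hr, mul_eq_zero, or_iff_right hk]
    constructor
    · intro h
      field_simp at h
      linear_combination h
    · intro h
      field_simp
      rw [h]
      ring
  rw [h, sq_eq_sq_iff_eq_or_eq_neg]

theorem mem_level_neg {n : ℕ} {x : F} : x ∈ level k (-r) n ↔ -x ∈ level k r n := by
  have h : Function.Semiconj (fun y : F => -y) (step k) (step k) := fun y => (step_neg y).symm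
  have h1 := (h.iterate_right n) x
  change (step k)^[n] x = -r ↔ (step k)^[n] (-x) = r
  rw [← h1]
  exact neg_eq_iff_eq_neg.symm

/-- The index shifts because r and −r already lie at depth one. Where `step` takes the value 0 the
maps differ later, `phi` going to ∞ and `step` staying at 0, but neither reaches its target. -/
theorem coe_mem_V_succ (hk : k ≠ 0) (hr : r ^ 2 = -1) {n : ℕ} {x : F} :
    (x : OnePoint F) ∈ V k (n + 1) ↔ x ∈ level k r n ∨ -x ∈ level k r n := by
  have hr0 : r ≠ 0 := by
    rintro rfl
    simp at hr
  rw [← mem_level_neg]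
  by_cases hx : x = 0
  · subst hx
    rw [mem_V_succ, phi_zero]
    exact iff_of_false (infty_notMem_V n) (not_or.2
      ⟨fun h => ne_zero_of_mem_level hr0 h rfl, fun h => ne_zero_of_mem_level (neg_ne_zero.2 hr0) h rfl⟩)
  induction n generalizing x with
  | zero =>
    rw [mem_V_succ, phi_coe_of_ne_zero hx, mem_V_zero, OnePoint.coe_eq_coe,
      step_eq_zero_iff hk hr hx]
    rfl
  | succ n ih =>
    rw [mem_V_succ, phi_coe_of_ne_zero hx]
    by_cases h0 : step k x = 0
    · rw [h0, mem_V_succ, phi_zero, mem_level_succ, mem_level_succ, h0]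
      exact iff_of_false (infty_notMem_V n) (not_or.2
        ⟨fun h => ne_zero_of_mem_level hr0 h rfl,
          fun h => ne_zero_of_mem_level (neg_ne_zero.2 hr0) h rfl⟩)
    · exact ih h0

theorem mem_T_succ_iff (hk : k ≠ 0) (hr : r ^ 2 = -1) {m : ℕ} {z : OnePoint F} :
    z ∈ T k (m + 1) ↔ ∃ x : F, z = x ∧ (x = 0 ∨ x ∈ ball k r m ∨ -x ∈ ball k r m) := by
  constructor
  · rintro ⟨i, hi, hz⟩
    induction z using OnePoint.rec with
    | infty => exact absurd hz (infty_notMem_V i)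
    | coe x =>
      refine ⟨x, rfl, ?_⟩
      cases i with
      | zero => exact Or.inl (OnePoint.coe_eq_coe.1 (mem_V_zero.1 hz))
      | succ i =>
        rcases (coe_mem_V_succ hk hr).1 hz with h | h
        · exact Or.inr (Or.inl ⟨i, by omega, h⟩)
        · exact Or.inr (Or.inr ⟨i, by omega, h⟩)
  · rintro ⟨x, rfl, rfl | ⟨i, hi, h⟩ | ⟨i, hi, h⟩⟩
    · exact ⟨0, Nat.zero_le _, rfl⟩
    · exact ⟨i + 1, by omega, (coe_mem_V_succ hk hr).2 (Or.inl h)⟩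
    · exact ⟨i + 1, by omega, (coe_mem_V_succ hk hr).2 (Or.inr h)⟩

theorem exists_eq_coe_of_mem_T {m : ℕ} {z : OnePoint F} (hz : z ∈ T k m) : ∃ x : F, z = x := by
  obtain ⟨i, _, hz⟩ := hz
  induction z using OnePoint.rec with
  | infty => exact absurd hz (infty_notMem_V i)
  | coe x => exact ⟨x, rfl⟩

theorem zero_mem_T (k : F) (m : ℕ) : ((0 : F) : OnePoint F) ∈ T k m :=
  ⟨0, Nat.zero_le _, rfl⟩

theorem phi_mem_T {m : ℕ} {z : OnePoint F} (hz : z ∈ T k m) (h0 : z ≠ ((0 : F) : OnePoint F)) :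
    phi k z ∈ T k m := by
  obtain ⟨i, hi, hz⟩ := hz
  cases i with
  | zero => exact absurd hz h0
  | succ i => exact ⟨i, by omega, mem_V_succ.1 hz⟩

/-- Tree automorphisms fix the root. -/
theorem treeAut_zero {m : ℕ} (c : TreeAut k m) :
    c ⟨_, zero_mem_T k m⟩ = ⟨_, zero_mem_T k m⟩ := by
  by_contra h
  have h0 : (c ⟨_, zero_mem_T k m⟩ : OnePoint F) ≠ ((0 : F) : OnePoint F) :=
    fun h1 => h (Subtype.ext h1)
  -- If the image of 0 were not 0, its parent would pull back to a parent of 0; but φ(0) = ∞ is not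
  -- a vertex.
  have h1 := phi_mem_T (c ⟨_, zero_mem_T k m⟩).2 h0
  obtain ⟨w, hw⟩ := c.surjective ⟨_, h1⟩
  have h2 : edge k m (c ⟨_, zero_mem_T k m⟩) (c w) := by
    rw [hw]
    rfl
  have h3 : phi k ((0 : F) : OnePoint F) = w := c.map_rel_iff.1 h2
  rw [phi_zero] at h3
  obtain ⟨x, hx⟩ := exists_eq_coe_of_mem_T w.2
  rw [← h3] at hx
  exact OnePoint.infty_ne_coe x hx

theorem coe_eq_zero_iff_treeAut {m : ℕ} (c : TreeAut k m) (v : T k m) :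
    (c v : OnePoint F) = ((0 : F) : OnePoint F) ↔ (v : OnePoint F) = ((0 : F) : OnePoint F) := by
  constructor
  · intro h
    have h1 : c v = c ⟨_, zero_mem_T k m⟩ := by
      rw [treeAut_zero]
      exact Subtype.ext h
    exact congrArg Subtype.val (c.injective h1)
  · intro h
    have h1 : v = ⟨_, zero_mem_T k m⟩ := Subtype.ext h
    rw [h1, treeAut_zero]

end Projective

/-! ### The Galois group inside the centralizer, and surjectivity. -/

section Action

variable {K E : Type*} [Field K] [Field E] [Algebra K E] {k : K}

theorem phi_map (σ : E ≃ₐ[K] E) (z : OnePoint E) :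
    phi (algebraMap K E k) (z.map σ) = (phi (algebraMap K E k) z).map σ := by
  induction z using OnePoint.rec with
  | infty => simp [phi_infty]
  | coe x =>
    by_cases hx : x = 0
    · subst hx
      simp [phi_zero]
    · rw [phi_coe_of_ne_zero hx, OnePoint.map_some, OnePoint.map_some,
        phi_coe_of_ne_zero (by simpa using hx), step_algEquiv]

theorem neg_map (σ : E ≃ₐ[K] E) (z : OnePoint E) : neg (z.map σ) = (neg z).map σ := by
  induction z using OnePoint.rec with
  | infty => simp [neg]
  | coe x => simp [neg]

theorem map_mem_V (σ : E ≃ₐ[K] E) {n : ℕ} {z : OnePoint E} (hz : z ∈ V (algebraMap K E k) n) :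
    z.map σ ∈ V (algebraMap K E k) n := by
  have h : Function.Semiconj (OnePoint.map σ) (phi (algebraMap K E k)) (phi (algebraMap K E k)) :=
    fun w => (phi_map σ w).symm
  have h1 := (h.iterate_right n) z
  rw [show (phi (algebraMap K E k))^[n] z = ((0 : E) : OnePoint E) from hz, OnePoint.map_some,
    map_zero] at h1
  exact h1.symm

theorem map_mem_T (σ : E ≃ₐ[K] E) {m : ℕ} {z : OnePoint E} (hz : z ∈ T (algebraMap K E k) m) :
    z.map σ ∈ T (algebraMap K E k) m := by
  obtain ⟨i, hi, hz⟩ := hz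
  exact ⟨i, hi, map_mem_V σ hz⟩

theorem map_map_algEquiv (σ τ : E ≃ₐ[K] E) (z : OnePoint E) :
    (z.map τ).map σ = z.map (σ * τ) := by
  induction z using OnePoint.rec with
  | infty => simp
  | coe x => simp

theorem map_one_algEquiv (z : OnePoint E) : z.map (1 : E ≃ₐ[K] E) = z := by
  induction z using OnePoint.rec with
  | infty => simp
  | coe x => simp

/-- The action of the Galois group on the vertices of the tree. -/
def galAct (k : K) (m : ℕ) : (E ≃ₐ[K] E) →* TreeAut (algebraMap K E k) m where
  toFun σ :=
    { toFun := fun v => ⟨(v : OnePoint E).map σ, map_mem_T σ v.2⟩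
      invFun := fun v => ⟨(v : OnePoint E).map (σ⁻¹ : E ≃ₐ[K] E), map_mem_T σ⁻¹ v.2⟩
      left_inv := fun v => Subtype.ext (by
        change OnePoint.map _ (OnePoint.map _ v.1) = v.1
        rw [map_map_algEquiv, inv_mul_cancel, map_one_algEquiv])
      right_inv := fun v => Subtype.ext (by
        change OnePoint.map _ (OnePoint.map _ v.1) = v.1
        rw [map_map_algEquiv, mul_inv_cancel, map_one_algEquiv])
      map_rel_iff' := by
        intro v w
        change phi _ (OnePoint.map σ v) = OnePoint.map σ w ↔ phi _ (v : OnePoint E) = w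
        rw [phi_map]
        refine ⟨fun h => ?_, fun h => by rw [h]⟩
        have h1 := congrArg (OnePoint.map (σ⁻¹ : E ≃ₐ[K] E)) h
        rwa [map_map_algEquiv, map_map_algEquiv, inv_mul_cancel, map_one_algEquiv,
          map_one_algEquiv] at h1 }
  map_one' := RelIso.ext fun v => Subtype.ext (map_one_algEquiv _)
  map_mul' σ τ := RelIso.ext fun v => Subtype.ext (map_map_algEquiv σ τ _).symm

theorem coe_galAct (m : ℕ) (σ : E ≃ₐ[K] E) (v : T (algebraMap K E k) m) :
    (galAct k m σ v : OnePoint E) = (v : OnePoint E).map σ := rfl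

theorem galAct_mem_C (m : ℕ) (σ : E ≃ₐ[K] E) : galAct k m σ ∈ C (algebraMap K E k) m := by
  rw [C, Subgroup.mem_centralizer_singleton_iff]
  exact RelIso.ext fun v => Subtype.ext (neg_map σ _).symm

/-- Every element of the centralizer that fixes the first level comes from the Galois group. -/
theorem exists_galAct_eq_of_fix [IsAlgClosed E] (h2 : (2 : E) ≠ 0) (hk : k ≠ 0) {r : E}
    (hr : r ^ 2 = -1) {m : ℕ} (hf : ∀ j < m, IsFullAt k r j)
    (hsep : ∀ j ≤ m, ∀ x ∈ level (algebraMap K E k) r j, x ≠ x⁻¹)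
    {c : TreeAut (algebraMap K E k) (m + 1)} (hc : c ∈ C (algebraMap K E k) (m + 1))
    (hcr : ∀ v : T (algebraMap K E k) (m + 1), (v : OnePoint E) = r → (c v : OnePoint E) = r) :
    ∃ σ : E ≃ₐ[K] E, galAct k (m + 1) σ = c := by
  classical
  have hk' : algebraMap K E k ≠ 0 := by simpa using hk
  have hr0 : r ≠ 0 := by
    rintro rfl
    simp at hr
  rw [C, Subgroup.mem_centralizer_singleton_iff] at hc
  -- Turns c into a function d on E, with the junk value 0 off the tree.
  have hex : ∀ x : E, ∃ y : E, ∀ h : (x : OnePoint E) ∈ T (algebraMap K E k) (m + 1),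
      (c ⟨x, h⟩ : OnePoint E) = y := by
    intro x
    by_cases h : (x : OnePoint E) ∈ T (algebraMap K E k) (m + 1)
    · obtain ⟨y, hy⟩ := exists_eq_coe_of_mem_T (c ⟨x, h⟩).2
      exact ⟨y, fun _ => hy⟩
    · exact ⟨0, fun h' => absurd h' h⟩
  choose d hd using hex
  have hT : ∀ x : E, (x = 0 ∨ x ∈ ball (algebraMap K E k) r m ∨ -x ∈ ball (algebraMap K E k) r m) →
      (x : OnePoint E) ∈ T (algebraMap K E k) (m + 1) := fun x hx =>
    (mem_T_succ_iff hk' hr).2 ⟨x, rfl, hx⟩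
  have hTl : ∀ j ≤ m, ∀ x ∈ level (algebraMap K E k) r j,
      (x : OnePoint E) ∈ T (algebraMap K E k) (m + 1) := fun j hj x hx =>
    hT x (Or.inr (Or.inl ⟨j, hj, hx⟩))
  have hdstep : ∀ j < m, ∀ x ∈ level (algebraMap K E k) r (j + 1),
      step (algebraMap K E k) (d x) = d (step (algebraMap K E k) x) := by
    intro j hj x hx
    have hx0 := ne_zero_of_mem_level hr0 hx
    have hxT := hTl _ (by omega) x hx
    have hyT := hTl j (by omega) _ (mem_level_succ.1 hx)
    have h1 : edge (algebraMap K E k) (m + 1) ⟨x, hxT⟩ ⟨_, hyT⟩ := phi_coe_of_ne_zero hx0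
    have h2 : phi _ (c ⟨x, hxT⟩ : OnePoint E) = (c ⟨_, hyT⟩ : OnePoint E) := c.map_rel_iff.2 h1
    have h3 : d x ≠ 0 := by
      intro h
      have h4 := hd x hxT
      rw [h, coe_eq_zero_iff_treeAut] at h4
      exact hx0 (OnePoint.coe_eq_coe.1 h4)
    rw [hd, hd, phi_coe_of_ne_zero h3] at h2
    exact OnePoint.coe_eq_coe.1 h2
  have hdinv : ∀ j < m, ∀ x ∈ level (algebraMap K E k) r (j + 1), d x⁻¹ = (d x)⁻¹ := by
    intro j hj x hx
    have hx' : x⁻¹ ∈ level (algebraMap K E k) r (j + 1) := by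
      rw [mem_level_succ, step_inv]
      exact hx
    have hne : ∀ y ∈ level (algebraMap K E k) r (j + 1), d y ≠ 0 := by
      intro y hy h
      have h4 := hd y (hTl _ (by omega) y hy)
      rw [h, coe_eq_zero_iff_treeAut] at h4
      exact ne_zero_of_mem_level hr0 hy (OnePoint.coe_eq_coe.1 h4)
    have h1 : step (algebraMap K E k) (d x⁻¹) = step (algebraMap K E k) (d x) := by
      rw [hdstep j hj _ hx', hdstep j hj _ hx, step_inv]
    -- x and 1/x have the same parent, hence so do their images, which differ because c is
    -- injective.
    refine (eq_or_eq_inv_of_step_eq hk' (hne _ hx') (hne _ hx) h1).resolve_left fun h => ?_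
    have h3 : c ⟨_, hTl _ (by omega) _ hx'⟩ = c ⟨_, hTl _ (by omega) _ hx⟩ :=
      Subtype.ext (by rw [hd, hd, h])
    exact hsep (j + 1) (by omega) x hx
      (OnePoint.coe_eq_coe.1 (congrArg Subtype.val (c.injective h3))).symm
  have hdr : d r = r := by
    have h1 := hTl 0 (Nat.zero_le m) r (mem_level_zero.2 rfl)
    exact OnePoint.coe_eq_coe.1 ((hd r h1).symm.trans (hcr ⟨r, h1⟩ rfl))
  obtain ⟨σ, hσ⟩ := exists_algEquiv_of_isFullAt h2 hk hr0 hf hdr hdstep hdinv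
  refine ⟨σ, RelIso.ext fun v => Subtype.ext ?_⟩
  obtain ⟨x, hvx, hx⟩ := (mem_T_succ_iff hk' hr).1 v.2
  have hv : v = ⟨(x : OnePoint E), hT x hx⟩ := Subtype.ext hvx
  rw [coe_galAct, hv]
  change OnePoint.map σ (x : OnePoint E) = _
  rw [OnePoint.map_some]
  rcases hx with rfl | hx | hx
  · rw [treeAut_zero, map_zero]
  · rw [hd, hσ x hx]
  -- On the half above −r, commuting with ι forces c(x) = −c(−x).
  · have h1 : iota (algebraMap K E k) (m + 1) ⟨_, hT (-x) (Or.inr (Or.inl hx))⟩ =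
        ⟨(x : OnePoint E), hT x (Or.inr (Or.inr hx))⟩ := Subtype.ext (by simp [iota, neg])
    have h3 := congrArg Subtype.val (DFunLike.congr_fun hc ⟨_, hT (-x) (Or.inr (Or.inl hx))⟩)
    rw [RelIso.mul_apply, RelIso.mul_apply, h1] at h3
    rw [h3]
    change _ = neg (c _ : OnePoint E)
    rw [hd, ← hσ _ hx]
    simp [neg]

/-- If c exchanges r and −r, compose it with a Galois element τ that does too; τ exists because −1
is not a square in K. -/
theorem exists_galAct_eq [IsAlgClosed E] [IsGalois K E] (h2 : (2 : E) ≠ 0) (hk : k ≠ 0)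
    (hneg : ¬ IsSquare (-1 : K)) {r : E}
    (hr : r ^ 2 = -1) {m : ℕ} (hf : ∀ j < m, IsFullAt k r j)
    (hsep : ∀ j ≤ m, ∀ x ∈ level (algebraMap K E k) r j, x ≠ x⁻¹)
    {c : TreeAut (algebraMap K E k) (m + 1)} (hc : c ∈ C (algebraMap K E k) (m + 1)) :
    ∃ σ : E ≃ₐ[K] E, galAct k (m + 1) σ = c := by
  have hk' : algebraMap K E k ≠ 0 := by simpa using hk
  have hr0 : r ≠ 0 := by
    rintro rfl
    simp at hr
  have hrT : (r : OnePoint E) ∈ T (algebraMap K E k) (m + 1) :=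
    (mem_T_succ_iff hk' hr).2 ⟨r, rfl, Or.inr (Or.inl (root_mem_ball _ r m))⟩
  obtain ⟨τ, hτ⟩ : ∃ τ : E ≃ₐ[K] E, τ r ≠ r := by
    by_contra! h
    obtain ⟨y, hy⟩ := (InfiniteGalois.mem_range_algebraMap_iff_fixed (k := K) (K := E) r).2 h
    refine hneg ⟨y, (algebraMap K E).injective ?_⟩
    rw [map_mul, hy, ← pow_two, hr, map_neg, map_one]
  have hτr : τ r = -r := by
    have : τ r ^ 2 = r ^ 2 := by rw [← map_pow, hr, map_neg, map_one]
    exact (sq_eq_sq_iff_eq_or_eq_neg.1 this).resolve_left hτ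
  obtain ⟨y, hy⟩ := exists_eq_coe_of_mem_T (c ⟨r, hrT⟩).2
  have hy0 : y ≠ 0 := by
    rintro rfl
    rw [coe_eq_zero_iff_treeAut] at hy
    exact hr0 (OnePoint.coe_eq_coe.1 hy)
  have hyr : y = r ∨ y = -r := by
    rw [← step_eq_zero_iff hk' hr hy0]
    have h1 : edge (algebraMap K E k) (m + 1) ⟨r, hrT⟩ ⟨_, zero_mem_T _ _⟩ := by
      change phi _ (r : OnePoint E) = _
      rw [phi_coe_of_ne_zero hr0, (step_eq_zero_iff hk' hr hr0).2 (Or.inl rfl)]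
    have h3 : phi _ (c ⟨r, hrT⟩ : OnePoint E) = (c ⟨_, zero_mem_T _ _⟩ : OnePoint E) :=
      c.map_rel_iff.2 h1
    rw [treeAut_zero, hy, phi_coe_of_ne_zero hy0] at h3
    exact OnePoint.coe_eq_coe.1 h3
  rcases hyr with rfl | rfl
  · refine exists_galAct_eq_of_fix h2 hk hr hf hsep hc fun v hv => ?_
    rw [show v = ⟨_, hrT⟩ from Subtype.ext hv, hy]
  · obtain ⟨σ, hσ⟩ := exists_galAct_eq_of_fix h2 hk hr hf hsep
      (mul_mem (galAct_mem_C (k := k) (m + 1) τ) hc) fun v hv => by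
        rw [show v = ⟨_, hrT⟩ from Subtype.ext hv, RelIso.mul_apply, coe_galAct, hy,
          OnePoint.map_some, map_neg, hτr, neg_neg]
    refine ⟨τ⁻¹ * σ, ?_⟩
    rw [map_mul, hσ, map_inv, inv_mul_cancel_left]

end Action

/-! ### Descent from the absolute Galois group to K_m. -/

section PreimageField

variable {K : Type*} [Field K] {k : K}

/-- Every vertex below level m is the image under φ of one a level higher, hence rational over it.
-/
theorem mem_preimageField_of_mem_V [NeZero (2 : AlgebraicClosure K)] (hk : k ≠ 0) {m i : ℕ}
    (him : i ≤ m) {x : AlgebraicClosure K}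
    (hx : (x : OnePoint (AlgebraicClosure K)) ∈ V (algebraMap K (AlgebraicClosure K) k) i) :
    x ∈ preimageField k m := by
  have hk' : algebraMap K (AlgebraicClosure K) k ≠ 0 := by simpa using hk
  obtain ⟨d, rfl⟩ := Nat.exists_eq_add_of_le him
  clear him
  induction d generalizing i x with
  | zero => exact IntermediateField.subset_adjoin K _ hx
  | succ d ih =>
    obtain ⟨y, hy0, rfl⟩ := exists_step_eq (NeZero.ne (2 : AlgebraicClosure K)) hk' x
    have hy : y ∈ preimageField k (i + 1 + d) := ih (by
      rw [mem_V_succ, phi_coe_of_ne_zero hy0]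
      exact hx)
    rw [show i + (d + 1) = i + 1 + d by ring]
    exact mul_mem (IntermediateField.algebraMap_mem _ k) (add_mem hy (inv_mem hy))

theorem normal_preimageField (k : K) (m : ℕ) : Normal K (preimageField k m) := by
  refine IntermediateField.normal_iff_forall_map_le'.2 fun σ => ?_
  rw [preimageField, IntermediateField.adjoin_map]
  refine IntermediateField.adjoin.mono K _ _ ?_
  rintro _ ⟨x, hx, rfl⟩
  exact map_mem_V σ hx

theorem galAct_ker [NeZero (2 : AlgebraicClosure K)] (hk : k ≠ 0) (m : ℕ) :
    (galAct (E := AlgebraicClosure K) k m).ker = (preimageField k m).fixingSubgroup := by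
  ext σ
  rw [MonoidHom.mem_ker, IntermediateField.mem_fixingSubgroup_iff]
  constructor
  · intro h
    -- The elements fixed by σ form an intermediate field, so it is enough to check the generators.
    have h1 : preimageField k m ≤ IntermediateField.fixedField (Subgroup.zpowers σ) := by
      refine IntermediateField.adjoin_le_iff.2 fun x hx => ?_
      have hxσ : σ x = x := by
        have := congrArg Subtype.val (DFunLike.congr_fun h ⟨(x : OnePoint _), m, le_rfl, hx⟩)
        exact OnePoint.coe_eq_coe.1 this
      rw [SetLike.mem_coe, IntermediateField.mem_fixedField_iff]
      intro τ hτ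
      have h2 : Subgroup.zpowers σ ≤ MulAction.stabilizer (AlgebraicClosure K ≃ₐ[K] _) x :=
        Subgroup.zpowers_le.2 hxσ
      exact h2 hτ
    intro x hx
    exact (IntermediateField.mem_fixedField_iff _ _).1 (h1 hx) σ (Subgroup.mem_zpowers σ)
  · intro h
    refine RelIso.ext fun v => Subtype.ext ?_
    obtain ⟨x, hx⟩ := exists_eq_coe_of_mem_T v.2
    obtain ⟨i, hi, hv⟩ := v.2
    rw [hx] at hv
    rw [coe_galAct, hx, OnePoint.map_some, h x (mem_preimageField_of_mem_V hk hi hv)]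
    exact hx.symm

end PreimageField

theorem exists_mulEquiv_of_ker_eq {Γ A B : Type*} [Group Γ] [Group A] [Group B] {f : Γ →* A}
    {g : Γ →* B} (hf : Function.Surjective f) (hg : Function.Surjective g) (h : f.ker = g.ker) :
    ∃ e : A ≃* B, ∀ σ, e (f σ) = g σ := by
  refine ⟨(QuotientGroup.quotientKerEquivOfSurjective f hf).symm.trans
    ((QuotientGroup.quotientMulEquivOfEq h).trans
      (QuotientGroup.quotientKerEquivOfSurjective g hg)), fun σ => ?_⟩
  have h1 : (QuotientGroup.quotientKerEquivOfSurjective f hf).symm (f σ) = (σ : Γ ⧸ f.ker) := by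
    rw [MulEquiv.symm_apply_eq]
    rfl
  rw [MulEquiv.trans_apply, h1]
  rfl

end Arboreal

theorem mainTheorem11 {K : Type*} [Field K] [NumberField K] (k : K) (hk : k ≠ 0)
    (m : ℕ) (hm : 1 ≤ m)
    (hneg : ¬ IsSquare (-1 : K))
    (hdelta : ∀ n : ℕ, 2 ≤ n → n ≤ m →
      ¬ IsSquare (FractionalIdeal.spanSingleton (𝓞 K)⁰ (Arboreal.delta k n) :
        FractionalIdeal (𝓞 K)⁰ K))
    (hunit : ∀ n : ℕ, 1 ≤ n → (n : ℚ) < (m : ℚ) / 2 + 1 →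
      ∀ p : IsDedekindDomain.HeightOneSpectrum (𝓞 K),
        p.asIdeal ∣ Ideal.span {((Arboreal.a n : ℤ) : 𝓞 K)} → p.valuation K k = 1) :
    ∃ e : Arboreal.G k m ≃* Arboreal.C (algebraMap K (AlgebraicClosure K) k) m,
      ∀ (g : Arboreal.G k m) (v : Arboreal.T (algebraMap K (AlgebraicClosure K) k) m),
        ∃ x : Arboreal.preimageField k m,
          (v : OnePoint (AlgebraicClosure K)) = ((x : AlgebraicClosure K) : OnePoint _) ∧
          (((e g : Arboreal.TreeAut (algebraMap K (AlgebraicClosure K) k) m) v :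
              Arboreal.T (algebraMap K (AlgebraicClosure K) k) m) :
            OnePoint (AlgebraicClosure K)) = ((g x : AlgebraicClosure K) : OnePoint _) := by
  obtain ⟨r, hr⟩ := IsAlgClosed.exists_pow_nat_eq (-1 : AlgebraicClosure K) (n := 2) (by norm_num)
  have hG : IsGalois K (AlgebraicClosure K) := inferInstance
  have h2 : (2 : AlgebraicClosure K) ≠ 0 := two_ne_zero
  have : NeZero (2 : AlgebraicClosure K) := ⟨h2⟩
  have := Arboreal.normal_preimageField k m
  have hsurj : Function.Surjective ((Arboreal.galAct (E := AlgebraicClosure K) k m).codRestrict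
      (Arboreal.C (algebraMap K (AlgebraicClosure K) k) m) (Arboreal.galAct_mem_C m)) := by
    obtain ⟨m, rfl⟩ := Nat.exists_eq_add_of_le' hm
    rintro ⟨c, hc⟩
    obtain ⟨σ, hσ⟩ := Arboreal.exists_galAct_eq h2 hk hneg hr
      (fun j hj => Arboreal.isFullAt_of_not_isSquare hk hdelta hunit hr (by omega))
      (fun j hj x hx => Arboreal.ne_inv_of_not_isSquare hk hdelta hr (by omega) hx) hc
    exact ⟨σ, Subtype.ext hσ⟩
  -- G_m and C_m are quotients of the absolute Galois group with the same kernel, the fixer of K_m.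
  obtain ⟨e, he⟩ := Arboreal.exists_mulEquiv_of_ker_eq
    (AlgEquiv.restrictNormalHom_surjective (F := K) (K₁ := Arboreal.preimageField k m)
      (AlgebraicClosure K)) hsurj
    (by rw [MonoidHom.ker_codRestrict, Arboreal.galAct_ker hk,
      IntermediateField.restrictNormalHom_ker])
  refine ⟨e, fun g v => ?_⟩
  obtain ⟨σ, rfl⟩ := AlgEquiv.restrictNormalHom_surjective (F := K)
    (K₁ := Arboreal.preimageField k m) (AlgebraicClosure K) g
  obtain ⟨x, hx⟩ := Arboreal.exists_eq_coe_of_mem_T v.2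
  obtain ⟨i, hi, hv⟩ := v.2
  rw [hx] at hv
  refine ⟨⟨x, Arboreal.mem_preimageField_of_mem_V hk hi hv⟩, hx, ?_⟩
  rw [he]
  change (Arboreal.galAct k m σ v : OnePoint (AlgebraicClosure K)) = _
  rw [Arboreal.coe_galAct, hx, OnePoint.map_some]
  congr 1
  exact (AlgEquiv.restrictNormalHom_apply (Arboreal.preimageField k m) σ
    ⟨x, Arboreal.mem_preimageField_of_mem_V hk hi hv⟩).symm
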